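/- Let $d\ge 1$, let $m,k$ be integers with $1\le k\le m-1$, and let $Z_1=(X_1,Y_1),\dots,Z_m=(X_m,Y_m)$ be i.i.d. random variables with values in $\mathbb R^d\times\{0,1\}$. Assume that almost surely there are no distance ties in the sample: $\|X_i-X_j\|\ne\|X_i-X_l\|$ for all pairwise distinct $i,j,l$. For $e\subset\{1,\dots,m\}$, let $\hat f_k(Z^e;x)$ be the $k$-nearest-neighbour classifier built from $Z^e=(Z_i)_{i\in e}$: it equals $1$ if $\frac1k\sum_{i\in V_k^e(x)}Y_i>\frac12$ and $0$ otherwise, where $V_k^e(x)$ is the set of indices of the $k$ points closest to $x$ (for the Euclidean distance) among $(X_i)_{i\in e}$. The leave-one-out (L1O) risk estimator is $$\widehat R_1=\frac1m\sum_{i=1}^m \mathbf 1\{\hat f_k(Z^{\{1,\dots,m\}\setminus\{i\}};X_i)\neq Y_i\}.$$ Let $\gamma_d$ be the constant of Stone's lemma, i.e. the smallest $\gamma\ge0$ such that for all $n$ and $k'$ and any $n$ points of $\mathbb R^d$ without distance ties, each of the points is one of the $k'$ nearest neighbours of at most $k'\gamma$ of the other points (for each of these, neighbours being taken among all points but itself).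 Let $\kappa$ be the constant of the generalized Efron–Stein inequality, i.e. the smallest $\kappa\ge0$ such that $$\|Z-\mathbb E Z\|_q\le\sqrt{2\kappa q}\,\Big\|\sum_{i=1}^n (Z-Z_i')^2\Big\|_{q/2}^{1/2}$$ for all $n$, all real $q\ge2$, all independent $X_1,\dots,X_n$ with values in a measurable space and every measurable $f$ such that $Z=f(X_1,\dots,X_n)$ is integrable, where $Z_i'=f(X_1,\dots,X_i',\dots,X_n)$ and $X_1',\dots,X_n'$ are independent copies of $X_1,\dots,X_n$. Then these constants exist (the two inequalities hold with finite constants $\gamma_d$, depending only on $d$, and $\kappa$, universal), $\kappa\le 1.271$, and: * $\displaystyle \mathbb E\big[(\widehat R_1-\mathbb E\widehat R_1)^2\big]\le C_1\sqrt k\,\Big(\frac{\sqrt k}{\sqrt m}\Big)^2=C_1\frac{k\sqrt k}{m}$, with $C_1=2+16\gamma_d$; * for every real $q>2$, $\displaystyle \mathbb E\big[|\widehat R_1-\mathbb E\widehat R_1|^q\big]\le (C_2\sqrt q)^q\Big(\frac{k}{\sqrt m}\Big)^q$, with $C_2=4\gamma_d\sqrt{2\kappa}$. -/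

import Mathlib

open MeasureTheory ProbabilityTheory

/-- No distance ties among the points `x 0, …, x (n-1)`: two distinct other points are never
at the same distance from a given point. -/
def NoTies {d n : ℕ} (x : Fin n → EuclideanSpace ℝ (Fin d)) : Prop :=
  ∀ i j l : Fin n, j ≠ i → l ≠ i → j ≠ l → dist (x i) (x j) ≠ dist (x i) (x l)

open Classical in
/-- The set `V_k(u)` of indices of the `k` nearest neighbours of `u` among the points `x i`, `i ∈ e`
(an index `i ∈ e` belongs to it if fewer than `k` indices of `e` come before it in the order by
distance to `u`; ties are broken by the index). -/
noncomputable def nearestNeighbors {d n : ℕ} (x : Fin n → EuclideanSpace ℝ (Fin d))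
    (e : Finset (Fin n)) (k : ℕ) (u : EuclideanSpace ℝ (Fin d)) : Finset (Fin n) :=
  e.filter fun i =>
    (e.filter fun j =>
      dist u (x j) < dist u (x i) ∨ (dist u (x j) = dist u (x i) ∧ j < i)).card < k

open Classical in
/-- The `k`NN classifier built from the subsample `(z i)_{i ∈ e}` of labelled points, evaluated
at `u`. The label `1` is `true` and the label `0` is `false`. -/
noncomputable def knnClassifier {d n : ℕ} (k : ℕ) (e : Finset (Fin n))
    (z : Fin n → EuclideanSpace ℝ (Fin d) × Bool) (u : EuclideanSpace ℝ (Fin d)) : Bool :=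
  if (1 / 2 : ℝ) < (1 / (k : ℝ)) *
      ∑ i ∈ nearestNeighbors (fun i => (z i).1) e k u, (if (z i).2 = true then (1 : ℝ) else 0)
  then true else false

/-- The leave-`p`-out risk estimator computed from the sample `z` of size `n`, for a classification
rule `f`, where `f e z` is the classifier built from the subsample `(z i)_{i ∈ e}`. -/
noncomputable def lpoEstimator {d n : ℕ} (p : ℕ)
    (f : Finset (Fin n) → (Fin n → EuclideanSpace ℝ (Fin d) × Bool) →
      EuclideanSpace ℝ (Fin d) → Bool)
    (z : Fin n → EuclideanSpace ℝ (Fin d) × Bool) : ℝ :=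
  ((n.choose p : ℕ) : ℝ)⁻¹ * ∑ e ∈ (Finset.univ : Finset (Fin n)).powersetCard (n - p),
    (1 / (p : ℝ)) * ∑ i ∈ eᶜ, (if f e z (z i).1 ≠ (z i).2 then (1 : ℝ) else 0)

/-- The leave-one-out risk estimator of the `k`NN classifier, computed from `m` labelled points. -/
noncomputable def knnLoo {d m : ℕ} (k : ℕ)
    (z : Fin m → EuclideanSpace ℝ (Fin d) × Bool) : ℝ :=
  lpoEstimator 1 (knnClassifier k) z

open Classical in
/-- `γ` is admissible in Stone's lemma in dimension `d`: among finitely many points without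
distance ties, each one is one of the `k` nearest neighbours of at most `k γ` of the others. -/
def IsStoneConstant (d : ℕ) (γ : ℝ) : Prop :=
  0 ≤ γ ∧ ∀ (n : ℕ) (x : Fin n → EuclideanSpace ℝ (Fin d)), NoTies x → ∀ (k : ℕ) (j : Fin n),
    ((Finset.univ.filter fun i : Fin n =>
      i ≠ j ∧ j ∈ nearestNeighbors x (Finset.univ.erase i) k (x i)).card : ℝ) ≤ k * γ

/-- The (smallest) constant `γ_d` of Stone's lemma. -/
noncomputable def stoneConstant (d : ℕ) : ℝ := sInf {γ : ℝ | IsStoneConstant d γ}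

/-- `κ` is admissible in the generalized Efron-Stein inequality
`‖Z - E Z‖_q ≤ √(2 κ q) * √(‖∑ i, (Z - Z_i')^2‖_{q/2})`, for every real `q ≥ 2`, where
`Z = f (X_1, …, X_n)`, the `X_i` are independent with laws `P i`, and `Z_i'` is obtained from `Z`
by replacing `X_i` with an independent copy `X_i'`. Both sides may be infinite. -/
def IsEfronSteinConstant (κ : ℝ) : Prop :=
  0 ≤ κ ∧ ∀ (n : ℕ) (E : Type) [MeasurableSpace E] (P : Fin n → Measure E)
    [∀ i, IsProbabilityMeasure (P i)] (f : (Fin n → E) → ℝ),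
    Measurable f → Integrable f (Measure.pi P) → ∀ q : ℝ, 2 ≤ q →
      eLpNorm (fun x => f x - ∫ y, f y ∂(Measure.pi P)) (ENNReal.ofReal q) (Measure.pi P) ≤
        ENNReal.ofReal (√(2 * κ * q)) *
          (eLpNorm (fun w : (Fin n → E) × (Fin n → E) =>
              ∑ i, (f w.1 - f (Function.update w.1 i (w.2 i))) ^ 2)
            (ENNReal.ofReal (q / 2)) ((Measure.pi P).prod (Measure.pi P))) ^ (1 / 2 : ℝ)

/-- The (smallest) universal constant `κ` of the generalized Efron-Stein inequality. -/
noncomputable def efronSteinConstant : ℝ := sInf {κ : ℝ | IsEfronSteinConstant κ}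

/-! The risk estimator is a function of independent variables, so its moments are controlled by the
increments obtained by replacing one `Z_i`. Three facts are needed: a moment inequality, Stone's
lemma, and a bound on the probability that a vote is tight.

Moment inequality, with constant 1 (stronger than 1.271). Let `f` be centred, `X'` an independent
copy of `X`, and replace the coordinates of `X` by those of `X'` one at a time. The expectation of
`h(f(X)) f(X)` telescopes, because the last term factors and vanishes. In each step, exchanging the
coordinate `j` between the samples flips the sign of the increment, so `h(f(X))` may be replaced by
half its own increment. Cauchy–Schwarz in weighted form leaves two sums of squared increments, but
along one fixed order the second is not a sum over all `j` for a single intermediate sample.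
Averaging over all orders repairs this: the step after `i` replacements costs at most `M / √(n (n -
i))`, and these costs add up to at most `2 M`. Taking `h(a) = a |a|^(q-2)` and Hölder's inequality
gives the result for bounded `f` (`integral_abs_rpow_le_of_bddMeas`); truncation and Fatou's lemma
remove boundedness.

Stability. Removing `i` changes the vote at `j` only if `i` is a neighbour of `j` and the `k + 1`
nearest neighbours of `j` carry exactly `⌊k/2⌋ + 1` labels 1. Stone's lemma (cones of small angle)
bounds the number of such `j` by `k γ`, so replacing a point moves the estimator by at most `(1 +
2kγ)/m`. This is all that the `q`-th moment needs.

The variance bound gains a factor of order `√k` because tight votes are rare. Conditionally on which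
points are the `k + 1` nearest ones and on the remaining points, these `k + 1` points are i.i.d. in
a fixed region, so their number of labels 1 is binomial and takes a given central value with
probability at most `2/√(k+1)` (`pi_numOnes_nearestNeighbors_le`). In the square of an increment,
one factor is bounded uniformly and the other by the number of tight votes, whose mean is summed
over `i`. -/

/-! ### Stability properties of bounded measurable functions -/

section BoundedMeasurable

variable {α β : Type*} [MeasurableSpace α] [MeasurableSpace β]

/-- Bounded measurable real functions. -/
def BddMeas (F : α → ℝ) : Prop := Measurable F ∧ ∃ C : ℝ, ∀ w, |F w| ≤ C

lemma BddMeas.integrable {F : α → ℝ} (hF : BddMeas F) (μ : Measure α) [IsFiniteMeasure μ] :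
    Integrable F μ := by
  obtain ⟨hm, C, hC⟩ := hF
  exact Integrable.of_bound hm.aestronglyMeasurable C (Filter.Eventually.of_forall hC)

lemma BddMeas.comp {F : α → ℝ} (hF : BddMeas F) {g : β → α} (hg : Measurable g) :
    BddMeas fun w => F (g w) :=
  ⟨hF.1.comp hg, hF.2.imp fun _ h w => h (g w)⟩

lemma BddMeas.const (c : ℝ) : BddMeas fun _ : α => c := ⟨measurable_const, |c|, fun _ => le_rfl⟩

lemma BddMeas.sub {F G : α → ℝ} (hF : BddMeas F) (hG : BddMeas G) :
    BddMeas fun w => F w - G w := by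
  obtain ⟨hm, C, hC⟩ := hF
  obtain ⟨hm', C', hC'⟩ := hG
  exact ⟨hm.sub hm', C + C', fun w => (abs_sub _ _).trans (add_le_add (hC w) (hC' w))⟩

lemma BddMeas.add {F G : α → ℝ} (hF : BddMeas F) (hG : BddMeas G) :
    BddMeas fun w => F w + G w := by
  obtain ⟨hm, C, hC⟩ := hF
  obtain ⟨hm', C', hC'⟩ := hG
  exact ⟨hm.add hm', C + C', fun w => (abs_add_le _ _).trans (add_le_add (hC w) (hC' w))⟩

lemma BddMeas.mul {F G : α → ℝ} (hF : BddMeas F) (hG : BddMeas G) :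
    BddMeas fun w => F w * G w := by
  obtain ⟨hm, C, hC⟩ := hF
  obtain ⟨hm', C', hC'⟩ := hG
  refine ⟨hm.mul hm', C * C', fun w => ?_⟩
  rw [abs_mul]
  exact mul_le_mul (hC w) (hC' w) (abs_nonneg _) ((abs_nonneg _).trans (hC w))

lemma BddMeas.abs {F : α → ℝ} (hF : BddMeas F) : BddMeas fun w => |F w| := by
  obtain ⟨hm, C, hC⟩ := hF
  exact ⟨hm.abs, C, fun w => by rw [abs_abs]; exact hC w⟩

lemma BddMeas.pow {F : α → ℝ} (hF : BddMeas F) (n : ℕ) : BddMeas fun w => F w ^ n := by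
  induction n with
  | zero => simpa using BddMeas.const 1
  | succ n ih => simpa only [pow_succ] using ih.mul hF

lemma BddMeas.sum {ι : Type*} {F : ι → α → ℝ} (s : Finset ι) (hF : ∀ i, BddMeas (F i)) :
    BddMeas fun w => ∑ i ∈ s, F i w := by
  classical
  induction s using Finset.induction_on with
  | empty => simpa using BddMeas.const 0
  | insert i s hi ih => simpa only [Finset.sum_insert hi] using (hF i).add ih

lemma BddMeas.continuous_comp {F : α → ℝ} (hF : BddMeas F) {h : ℝ → ℝ} (hh : Continuous h) :
    BddMeas fun w => h (F w) := by
  obtain ⟨hm, C, hC⟩ := hF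
  obtain ⟨B, hB⟩ := (isCompact_Icc (a := -C) (b := C)).exists_bound_of_continuousOn hh.continuousOn
  exact ⟨hh.measurable.comp hm, B, fun w => hB _ (abs_le.1 (hC w))⟩

end BoundedMeasurable

/-! ### Exchanging coordinates between two independent samples -/

section Swap

variable {n : ℕ} {E : Type*}

/-- Exchange the coordinates indexed by `A` between the two components of a pair of samples. -/
def swapOn (A : Finset (Fin n)) (w : (Fin n → E) × (Fin n → E)) : (Fin n → E) × (Fin n → E) :=
  (A.piecewise w.2 w.1, A.piecewise w.1 w.2)

lemma swapOn_singleton_fst (j : Fin n) (w : (Fin n → E) × (Fin n → E)) :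
    (swapOn {j} w).1 = Function.update w.1 j (w.2 j) := by
  simp [swapOn, Finset.piecewise_singleton]

lemma swapOn_insert_fst {A : Finset (Fin n)} {j : Fin n} (hj : j ∉ A)
    (w : (Fin n → E) × (Fin n → E)) :
    (swapOn (insert j A) w).1 =
      Function.update (swapOn A w).1 j ((swapOn A w).2 j) := by
  simp [swapOn, Finset.piecewise_insert, hj]

lemma swapOn_swapOn_singleton {A : Finset (Fin n)} {j : Fin n} (hj : j ∉ A)
    (w : (Fin n → E) × (Fin n → E)) :
    swapOn A (swapOn {j} w) = swapOn {j} (swapOn A w) := by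
  refine Prod.ext ?_ ?_ <;> funext i <;> by_cases h : i ∈ A <;> by_cases h' : i = j <;>
    simp_all [swapOn, Finset.piecewise]

/-- The increment of `f` when the coordinate `j` of the first sample is replaced by that of the
second one. -/
def coordDiff (f : (Fin n → E) → ℝ) (j : Fin n) (w : (Fin n → E) × (Fin n → E)) : ℝ :=
  f w.1 - f (Function.update w.1 j (w.2 j))

lemma coordDiff_swapOn_singleton (f : (Fin n → E) → ℝ) (j : Fin n)
    (w : (Fin n → E) × (Fin n → E)) : coordDiff f j (swapOn {j} w) = -coordDiff f j w := by
  simp [coordDiff, swapOn, Finset.piecewise_singleton]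

lemma coordDiff_swapOn {A : Finset (Fin n)} {j : Fin n} (hj : j ∉ A) (f : (Fin n → E) → ℝ)
    (w : (Fin n → E) × (Fin n → E)) :
    coordDiff f j (swapOn A w) = f (swapOn A w).1 - f (swapOn (insert j A) w).1 := by
  rw [swapOn_insert_fst hj, coordDiff]

variable [MeasurableSpace E]

/-- A pair of samples is a sample of pairs; the pair at `i` has law `P i ⊗ P i`, which is symmetric
under exchange of its components. -/
lemma measurePreserving_swapOn (P : Fin n → Measure E) [∀ i, IsProbabilityMeasure (P i)]
    (A : Finset (Fin n)) :
    MeasurePreserving (swapOn A) ((Measure.pi P).prod (Measure.pi P))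
      ((Measure.pi P).prod (Measure.pi P)) := by
  have h1 := measurePreserving_arrowProdEquivProdArrow E E (Fin n) P P
  have h2 : MeasurePreserving (fun (a : Fin n → E × E) i => (if i ∈ A then Prod.swap else id) (a i))
      (Measure.pi fun i => (P i).prod (P i)) (Measure.pi fun i => (P i).prod (P i)) := by
    refine measurePreserving_pi (fun i => (P i).prod (P i)) (fun i => (P i).prod (P i))
      (f := fun i => if i ∈ A then Prod.swap else id) fun i => ?_
    by_cases h : i ∈ A
    · simp only [h, if_true]; exact Measure.measurePreserving_swap
    · simp only [h, if_false]; exact MeasurePreserving.id _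
  have h3 := h1.comp (h2.comp (h1.symm _))
  convert h3 using 1
  funext w
  refine Prod.ext ?_ ?_ <;> funext i <;> by_cases h : i ∈ A <;>
    simp [swapOn, h, MeasurableEquiv.arrowProdEquivProdArrow, Equiv.arrowProdEquivProdArrow,
      Finset.piecewise, MeasurableEquiv.symm]

lemma measurable_swapOn (A : Finset (Fin n)) :
    Measurable (swapOn A : (Fin n → E) × (Fin n → E) → _) := by
  refine Measurable.prodMk ?_ ?_ <;> refine measurable_pi_lambda _ fun i => ?_ <;>
    by_cases h : i ∈ A <;> simp only [Finset.piecewise, h, if_true, if_false] <;> fun_prop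

lemma BddMeas.fst {f : (Fin n → E) → ℝ} (hf : BddMeas f) :
    BddMeas fun w : (Fin n → E) × (Fin n → E) => f w.1 := hf.comp measurable_fst

lemma measurable_update_pair (j : Fin n) :
    Measurable fun w : (Fin n → E) × (Fin n → E) => Function.update w.1 j (w.2 j) := by
  simp_rw [← swapOn_singleton_fst]
  exact (measurable_swapOn _).fst

lemma BddMeas.coordDiff {f : (Fin n → E) → ℝ} (hf : BddMeas f) (j : Fin n) :
    BddMeas (coordDiff f j) := hf.fst.sub (hf.comp (measurable_update_pair j))

/-- Bound for one step of the interpolation between the two samples. -/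
lemma integral_mul_coordDiff_swapOn_le (P : Fin n → Measure E) [∀ i, IsProbabilityMeasure (P i)]
    {f : (Fin n → E) → ℝ} (hf : BddMeas f) {h g : ℝ → ℝ} (hh : Continuous h) (hg : Continuous g)
    (hhg : ∀ a b, |h a - h b| ≤ (g a + g b) * |a - b|) {A : Finset (Fin n)} {j : Fin n}
    (hj : j ∉ A) :
    ∫ w, h (f w.1) * coordDiff f j (swapOn A w) ∂((Measure.pi P).prod (Measure.pi P)) ≤
      ∫ w, g (f w.1) * (|coordDiff f j w| * |coordDiff f j (swapOn A w)|)
        ∂((Measure.pi P).prod (Measure.pi P)) := by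
  set ν := (Measure.pi P).prod (Measure.pi P)
  have hS : ∀ {F : (Fin n → E) × (Fin n → E) → ℝ}, BddMeas F →
      ∫ w, F (swapOn {j} w) ∂ν = ∫ w, F w ∂ν := fun {F} hF => by
    have := (measurePreserving_swapOn P {j}).map_eq
    rw [← integral_map (measurable_swapOn _).aemeasurable hF.1.aestronglyMeasurable, this]
  have hD := hf.coordDiff j
  have hDA : BddMeas fun w => coordDiff f j (swapOn A w) := hD.comp (measurable_swapOn A)
  have hF : BddMeas fun w => h (f w.1) * coordDiff f j (swapOn A w) :=
    (hf.fst.continuous_comp hh).mul hDA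
  have hG : BddMeas fun w => g (f w.1) * (|coordDiff f j w| * |coordDiff f j (swapOn A w)|) :=
    (hf.fst.continuous_comp hg).mul (hD.abs.mul hDA.abs)
  have e1 := hS hF
  have e2 := hS hG
  have hcomm := fun w : (Fin n → E) × (Fin n → E) => swapOn_swapOn_singleton hj w
  simp only [hcomm, coordDiff_swapOn_singleton, abs_neg] at e1 e2
  have i1 := (hF.integrable ν)
  have i1' := ((hF.comp (measurable_swapOn {j})).integrable ν)
  have i2 := (hG.integrable ν)
  have i2' := ((hG.comp (measurable_swapOn {j})).integrable ν)
  simp only [hcomm, coordDiff_swapOn_singleton, abs_neg] at i1' i2'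
  -- Each integral is added to its image under the exchange of coordinate `j`. The increment changes
  -- sign on the left, so the sum contains the difference of two values of `h`; on the right both
  -- copies have the same integral.
  have key := integral_mono (i1.add i1') (i2.add i2') (fun w => by
    simp only [Pi.add_apply, swapOn_singleton_fst]
    have := hhg (f w.1) (f (Function.update w.1 j (w.2 j)))
    calc _ = (h (f w.1) - h (f (Function.update w.1 j (w.2 j)))) * coordDiff f j (swapOn A w) := by
          ring
      _ ≤ |h (f w.1) - h (f (Function.update w.1 j (w.2 j)))| * |coordDiff f j (swapOn A w)| := by
          rw [← abs_mul]; exact le_abs_self _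
      _ ≤ ((g (f w.1) + g (f (Function.update w.1 j (w.2 j)))) *
          |f w.1 - f (Function.update w.1 j (w.2 j))|) * |coordDiff f j (swapOn A w)| := by gcongr
      _ = _ := by rw [← coordDiff]; ring)
  simp only [Pi.add_apply] at key
  rw [integral_add i1 i1', integral_add i2 i2', e1, e2] at key
  linarith

end Swap

/-! ### Averaging over the orders of replacement -/

section Order
variable {n : ℕ}

/-- The elements which come at one of the first `t` places in the order `σ`. -/
def initialPart (σ : Equiv.Perm (Fin n)) (t : ℕ) : Finset (Fin n) :=
  Finset.univ.filter fun j => (σ j : ℕ) < t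

lemma mem_initialPart {σ : Equiv.Perm (Fin n)} {t : ℕ} {j : Fin n} :
    j ∈ initialPart σ t ↔ (σ j : ℕ) < t := by simp [initialPart]

lemma initialPart_succ (σ : Equiv.Perm (Fin n)) (i : Fin n) :
    initialPart σ (i + 1) = insert (σ.symm i) (initialPart σ i) := by
  ext j
  simp only [initialPart, Finset.mem_filter, Finset.mem_univ, true_and, Finset.mem_insert,
    Nat.lt_succ_iff_lt_or_eq, Equiv.eq_symm_apply, Fin.ext_iff]
  tauto

lemma symm_notMem_initialPart (σ : Equiv.Perm (Fin n)) (i : Fin n) :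
    σ.symm i ∉ initialPart σ i := by simp [initialPart]

/-- Given the set of the first `t` elements of a uniform random order, the element at any place `i ≥
t` is uniform among the `n - t` remaining ones. -/
lemma sum_initialPart_symm_le {r : Finset (Fin n) → Fin n → ℝ} (hr : ∀ A j, 0 ≤ r A j) {M : ℝ}
    (hM : ∀ A, ∑ j, r A j ≤ M) (t : ℕ) (i : Fin n) (hti : t ≤ i) :
    ((n : ℝ) - t) * ∑ σ : Equiv.Perm (Fin n), r (initialPart σ t) (σ.symm i) ≤
      (n.factorial : ℝ) * M := by
  have h1 : ∀ l : Fin n, t ≤ l → ∑ σ : Equiv.Perm (Fin n), r (initialPart σ t) (σ.symm i) =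
      ∑ σ : Equiv.Perm (Fin n), r (initialPart σ t) (σ.symm l) := fun l hl => by
    -- Exchanging the places `i` and `l`, both at least `t`, leaves the initial part unchanged.
    refine Fintype.sum_equiv (Equiv.mulLeft (Equiv.swap i l)) _ _ fun σ => ?_
    have hA : initialPart (Equiv.swap i l * σ) t = initialPart σ t := by
      ext j
      simp only [mem_initialPart, Equiv.Perm.mul_apply]
      rcases eq_or_ne (σ j) i with h | h
      · rw [h, Equiv.swap_apply_left]; omega
      rcases eq_or_ne (σ j) l with h' | h'
      · rw [h', Equiv.swap_apply_right]; omega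
      rw [Equiv.swap_apply_of_ne_of_ne h h']
    have hs : (Equiv.swap i l * σ).symm l = σ.symm i := by
      rw [Equiv.symm_apply_eq]; simp
    simp only [Equiv.coe_mulLeft, hA, hs]
  have hcard : ((Finset.univ.filter fun l : Fin n => t ≤ l).card : ℝ) = (n : ℝ) - t := by
    have : (Finset.univ.filter fun l : Fin n => t ≤ l) = Finset.Ici ⟨t, by omega⟩ := by
      ext l; simp [Fin.le_def]
    rw [this, Fin.card_Ici, Nat.cast_sub (by simp; omega)]
  calc _ = ∑ l ∈ Finset.univ.filter fun l : Fin n => t ≤ l,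
        ∑ σ : Equiv.Perm (Fin n), r (initialPart σ t) (σ.symm l) := by
        rw [← hcard, ← nsmul_eq_mul, ← Finset.sum_const]
        exact Finset.sum_congr rfl fun l hl => h1 l (Finset.mem_filter.1 hl).2
    _ = ∑ σ : Equiv.Perm (Fin n), ∑ l ∈ Finset.univ.filter fun l : Fin n => t ≤ l,
        r (initialPart σ t) (σ.symm l) := Finset.sum_comm
    _ ≤ ∑ σ : Equiv.Perm (Fin n), M := Finset.sum_le_sum fun σ _ => by
        refine le_trans (Finset.sum_le_sum_of_subset_of_nonneg (Finset.subset_univ _)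
          fun _ _ _ => hr _ _) ?_
        rw [Equiv.sum_comp σ.symm (r (initialPart σ t))]
        exact hM _
    _ = _ := by simp [Fintype.card_perm]

lemma sum_one_div_sqrt_le (n : ℕ) : ∑ i ∈ Finset.range n, 1 / √((i : ℝ) + 1) ≤ 2 * √n := by
  induction n with
  | zero => simp
  | succ n ih =>
    rw [Finset.sum_range_succ]
    have h0 : 0 < √((n : ℝ) + 1) := by positivity
    have h1 := Real.sq_sqrt (show (0 : ℝ) ≤ n + 1 by positivity)
    have h2 := Real.sq_sqrt (show (0 : ℝ) ≤ n by positivity)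
    have h3 := Real.sqrt_nonneg (n : ℝ)
    have : 1 / √((n : ℝ) + 1) ≤ 2 * √((n : ℝ) + 1) - 2 * √n := by
      rw [div_le_iff₀ h0]
      nlinarith [sq_nonneg (√((n : ℝ) + 1) - √n)]
    push_cast
    linarith

/-- Averaged over all orders, products of the increments along an order are controlled by the sums
of their squares. -/
lemma sum_perm_sum_le {p : Fin n → ℝ} {r : Finset (Fin n) → Fin n → ℝ}
    {s : Finset (Fin n) → Fin n → ℝ} (hp : ∀ j, 0 ≤ p j) (hr : ∀ A j, 0 ≤ r A j) {M : ℝ}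
    (hpM : ∑ j, p j ≤ M) (hrM : ∀ A, ∑ j, r A j ≤ M)
    (hs : ∀ A j (c : ℝ), 0 < c → s A j ≤ (c * p j + c⁻¹ * r A j) / 2) :
    ∑ σ : Equiv.Perm (Fin n), ∑ i : Fin n, s (initialPart σ i) (σ.symm i) ≤
      (n.factorial : ℝ) * (2 * M) := by
  rcases Nat.eq_zero_or_pos n with rfl | hn
  · have : 0 ≤ M := by simpa using hpM
    simpa using this
  have hM : 0 ≤ M := (Finset.sum_nonneg fun j _ => hp j).trans hpM
  have hn' : (0 : ℝ) < n := by exact_mod_cast hn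
  have hbd : ∀ i : Fin n, ∑ σ : Equiv.Perm (Fin n), s (initialPart σ i) (σ.symm i) ≤
      (n.factorial : ℝ) * M * (1 / (√n * √((n : ℝ) - i))) := fun i => by
    have hi : (0 : ℝ) < (n : ℝ) - i := by
      have : ((i : ℕ) : ℝ) < n := by exact_mod_cast i.2
      linarith
    have h1 := sum_initialPart_symm_le (r := fun _ => p) (fun _ => hp) (fun _ => hpM) 0 i (by omega)
    have h2 := sum_initialPart_symm_le hr hrM i i le_rfl
    simp only [Nat.cast_zero, sub_zero] at h1
    set a := √(n : ℝ)
    set b := √((n : ℝ) - i)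
    have ha : 0 < a := Real.sqrt_pos.2 hn'
    have hb : 0 < b := Real.sqrt_pos.2 hi
    have ha2 : a * a = n := Real.mul_self_sqrt hn'.le
    have hb2 : b * b = (n : ℝ) - i := Real.mul_self_sqrt hi.le
    rw [← ha2] at h1
    rw [← hb2] at h2
    set S1 := ∑ σ : Equiv.Perm (Fin n), p (σ.symm i)
    set S2 := ∑ σ : Equiv.Perm (Fin n), r (initialPart σ i) (σ.symm i)
    -- The averages of `p` and `r` are at most `M / n` and `M / (n - i)`; the weight `√(n / (n -
    -- i))` balances these two bounds and yields their geometric mean.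
    calc _ ≤ ∑ σ : Equiv.Perm (Fin n), ((a / b) * p (σ.symm i) +
          (a / b)⁻¹ * r (initialPart σ i) (σ.symm i)) / 2 :=
          Finset.sum_le_sum fun σ _ => hs _ _ _ (by positivity)
      _ = ((a / b) * S1 + (a / b)⁻¹ * S2) / 2 := by
          rw [← Finset.sum_div, Finset.sum_add_distrib, ← Finset.mul_sum, ← Finset.mul_sum]
      _ = (a * a * S1 + b * b * S2) / (2 * (a * b)) := by field_simp
      _ ≤ (n.factorial * M + n.factorial * M) / (2 * (a * b)) := by gcongr
      _ = _ := by field_simp; ring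
  have hsum : ∑ i : Fin n, 1 / (√n * √((n : ℝ) - i)) ≤ 2 := by
    rw [Fin.sum_univ_eq_sum_range (fun i => 1 / (√n * √((n : ℝ) - i))) n,
      ← Finset.sum_range_reflect]
    have := sum_one_div_sqrt_le n
    have hs0 : (0 : ℝ) < √n := Real.sqrt_pos.2 hn'
    calc _ = (1 / √n) * ∑ i ∈ Finset.range n, 1 / √((i : ℝ) + 1) := by
          rw [Finset.mul_sum]
          refine Finset.sum_congr rfl fun i hi => ?_
          have hi := Finset.mem_range.1 hi
          have : (n : ℝ) - ((n - 1 - i : ℕ) : ℝ) = (i : ℝ) + 1 := by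
            rw [Nat.cast_sub (by omega), Nat.cast_sub (by omega)]; push_cast; ring
          rw [this, one_div_mul_one_div]
      _ ≤ (1 / √n) * (2 * √n) := by gcongr
      _ = 2 := by field_simp
  rw [Finset.sum_comm]
  calc _ ≤ ∑ i : Fin n, (n.factorial : ℝ) * M * (1 / (√n * √((n : ℝ) - i))) :=
        Finset.sum_le_sum fun i _ => hbd i
    _ = (n.factorial : ℝ) * M * ∑ i : Fin n, 1 / (√n * √((n : ℝ) - i)) := by rw [Finset.mul_sum]
    _ ≤ (n.factorial : ℝ) * M * 2 := by gcongr
    _ = _ := by ring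

end Order

/-! ### Moment inequalities for bounded functions -/

section EfronStein

variable {n : ℕ} {E : Type*} [MeasurableSpace E]

lemma BddMeas.integral_swapOn (P : Fin n → Measure E) [∀ i, IsProbabilityMeasure (P i)]
    {F : (Fin n → E) × (Fin n → E) → ℝ} (hF : BddMeas F) (A : Finset (Fin n)) :
    ∫ w, F (swapOn A w) ∂((Measure.pi P).prod (Measure.pi P)) =
      ∫ w, F w ∂((Measure.pi P).prod (Measure.pi P)) := by
  have := (measurePreserving_swapOn P A).map_eq
  rw [← integral_map (measurable_swapOn _).aemeasurable hF.1.aestronglyMeasurable, this]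

lemma integral_prod_fst (P : Fin n → Measure E) [∀ i, IsProbabilityMeasure (P i)]
    (F : (Fin n → E) → ℝ) :
    ∫ w, F w.1 ∂((Measure.pi P).prod (Measure.pi P)) = ∫ x, F x ∂(Measure.pi P) := by
  simpa using integral_fun_fst (μ := Measure.pi P) (ν := Measure.pi P) F

/-- The sum of the squared increments. -/
def sumSqDiff (f : (Fin n → E) → ℝ) (w : (Fin n → E) × (Fin n → E)) : ℝ :=
  ∑ j, (coordDiff f j w) ^ 2

lemma BddMeas.sumSqDiff {f : (Fin n → E) → ℝ} (hf : BddMeas f) : BddMeas (sumSqDiff f) :=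
  BddMeas.sum _ fun j => (hf.coordDiff j).pow 2

/-- Each order gives a telescoping bound for the same left-hand side, so the bound may be averaged
over orders by `sum_perm_sum_le`. The hypothesis on `M` must cover every `A`, since the increments
at intermediate samples are weighted by `g` at the original one. -/
theorem integral_mul_self_le_of_bddMeas (P : Fin n → Measure E) [∀ i, IsProbabilityMeasure (P i)]
    {f : (Fin n → E) → ℝ} (hf : BddMeas f) (hf0 : ∫ x, f x ∂(Measure.pi P) = 0) {h g : ℝ → ℝ}
    (hh : Continuous h) (hg : Continuous g) (hg0 : ∀ a, 0 ≤ g a)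
    (hhg : ∀ a b, |h a - h b| ≤ (g a + g b) * |a - b|) {M : ℝ}
    (hM : ∀ A : Finset (Fin n), ∫ w, g (f w.1) * sumSqDiff f (swapOn A w)
      ∂((Measure.pi P).prod (Measure.pi P)) ≤ M) :
    ∫ x, h (f x) * f x ∂(Measure.pi P) ≤ 2 * M := by
  set ν := (Measure.pi P).prod (Measure.pi P) with hν
  have hgf := hf.fst.continuous_comp hg
  have hhf := hf.continuous_comp hh
  have hD := fun (A : Finset (Fin n)) j => (hf.coordDiff j).comp (measurable_swapOn A)
  let r : Finset (Fin n) → Fin n → ℝ := fun A j =>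
    ∫ w, g (f w.1) * (coordDiff f j (swapOn A w)) ^ 2 ∂ν
  let s : Finset (Fin n) → Fin n → ℝ := fun A j =>
    ∫ w, g (f w.1) * (|coordDiff f j w| * |coordDiff f j (swapOn A w)|) ∂ν
  have hr : ∀ A j, 0 ≤ r A j := fun A j => integral_nonneg fun w =>
    mul_nonneg (hg0 _) (sq_nonneg _)
  have hrM : ∀ A, ∑ j, r A j ≤ M := fun A => by
    refine le_trans (le_of_eq ?_) (hM A)
    simp only [r, sumSqDiff, Finset.mul_sum]
    rw [integral_finsetSum _ fun j _ => (hgf.mul ((hD A j).pow 2)).integrable ν]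
  have h0 : ∀ w : (Fin n → E) × (Fin n → E), swapOn ∅ w = w := fun w => by simp [swapOn]
  have hs : ∀ A j (c : ℝ), 0 < c → s A j ≤ (c * r ∅ j + c⁻¹ * r A j) / 2 := fun A j c hc => by
    simp only [r, s, h0]
    rw [← integral_const_mul, ← integral_const_mul, ← integral_add, ← integral_div]
    · refine integral_mono ((hgf.mul ((hf.coordDiff j).abs.mul (hD A j).abs)).integrable ν) ?_ ?_
      · exact ((((hgf.mul ((hf.coordDiff j).pow 2)).integrable ν).const_mul c).add
          (((hgf.mul ((hD A j).pow 2)).integrable ν).const_mul c⁻¹)).div_const 2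
      intro w
      simp only
      rw [← sq_abs (coordDiff f j w), ← sq_abs (coordDiff f j (swapOn A w))]
      set x := |coordDiff f j w|
      set y := |coordDiff f j (swapOn A w)|
      have : x * y ≤ (c * x ^ 2 + c⁻¹ * y ^ 2) / 2 := by
        have : c * x ^ 2 + c⁻¹ * y ^ 2 - 2 * (x * y) = c⁻¹ * (c * x - y) ^ 2 := by field_simp; ring
        have h2 : 0 ≤ c⁻¹ * (c * x - y) ^ 2 := by positivity
        linarith
      calc _ ≤ g (f w.1) * ((c * x ^ 2 + c⁻¹ * y ^ 2) / 2) :=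
            mul_le_mul_of_nonneg_left this (hg0 _)
        _ = _ := by ring
    · exact ((hgf.mul ((hf.coordDiff j).pow 2)).integrable ν).const_mul c
    · exact ((hgf.mul ((hD A j).pow 2)).integrable ν).const_mul c⁻¹
  have key := sum_perm_sum_le (hr ∅) hr (hrM ∅) hrM hs
  have hσ : ∀ σ : Equiv.Perm (Fin n), ∫ x, h (f x) * f x ∂(Measure.pi P) ≤
      ∑ i : Fin n, s (initialPart σ i) (σ.symm i) := fun σ => by
    let G : ℕ → ℝ := fun t => ∫ w, h (f w.1) * f (swapOn (initialPart σ t) w).1 ∂ν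
    have hG : ∀ A : Finset (Fin n), BddMeas fun w => h (f w.1) * f (swapOn A w).1 := fun A =>
      hhf.fst.mul (hf.comp (measurable_swapOn A).fst)
    have e0 : G 0 = ∫ x, h (f x) * f x ∂(Measure.pi P) := by
      have : initialPart σ 0 = ∅ := by ext; simp [mem_initialPart]
      simp only [G, this, h0]
      exact integral_prod_fst P fun x => h (f x) * f x
    -- Once all coordinates are exchanged, the second factor is independent of the first and has
    -- mean zero.
    have en : G n = 0 := by
      have : initialPart σ n = Finset.univ := by ext; simp [mem_initialPart]
      simp only [G, this]
      have h1 : ∀ w : (Fin n → E) × (Fin n → E), (swapOn Finset.univ w).1 = w.2 := fun w => by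
        simp [swapOn]
      simp only [h1]
      rw [hν, integral_prod_mul (fun x => h (f x)) f, hf0, mul_zero]
    rw [← e0, ← sub_zero (G 0), ← en, ← Finset.sum_range_sub' G n,
      ← Fin.sum_univ_eq_sum_range (fun t => G t - G (t + 1)) n]
    refine Finset.sum_le_sum fun i _ => ?_
    refine le_trans (le_of_eq ?_)
      (integral_mul_coordDiff_swapOn_le P hf hh hg hhg (symm_notMem_initialPart σ i))
    simp only [G]
    rw [initialPart_succ, ← integral_sub ((hG _).integrable _) ((hG _).integrable _)]
    refine integral_congr_ae (Filter.Eventually.of_forall fun w => ?_)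
    simp only
    rw [coordDiff_swapOn (symm_notMem_initialPart σ i)]
    ring
  have h1 : (n.factorial : ℝ) * ∫ x, h (f x) * f x ∂(Measure.pi P) ≤
      (n.factorial : ℝ) * (2 * M) := by
    refine le_trans ?_ key
    calc _ = ∑ σ : Equiv.Perm (Fin n), ∫ x, h (f x) * f x ∂(Measure.pi P) := by
          simp [Fintype.card_perm]
      _ ≤ _ := Finset.sum_le_sum fun σ _ => hσ σ
  exact le_of_mul_le_mul_left h1 (by positivity)

/-- A weak form of the Efron-Stein inequality. -/
theorem integral_sq_le_of_bddMeas (P : Fin n → Measure E) [∀ i, IsProbabilityMeasure (P i)]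
    {f : (Fin n → E) → ℝ} (hf : BddMeas f) (hf0 : ∫ x, f x ∂(Measure.pi P) = 0) :
    ∫ x, (f x) ^ 2 ∂(Measure.pi P) ≤
      ∫ w, sumSqDiff f w ∂((Measure.pi P).prod (Measure.pi P)) := by
  have := integral_mul_self_le_of_bddMeas P hf hf0 (h := id) (g := fun _ => 1 / 2) continuous_id
    continuous_const (fun _ => by norm_num) (fun a b => by simp only [id]; linarith)
    (M := 1 / 2 * ∫ w, sumSqDiff f w ∂((Measure.pi P).prod (Measure.pi P))) (fun A => by
      rw [integral_const_mul, hf.sumSqDiff.integral_swapOn P])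
  simp only [id, ← sq] at this
  linarith

/-- The derivative of `a |a|^r` is `(r + 1) |a|^r`. Only the term of the larger of `|a|`, `|b|` is
really needed; Bernoulli's inequality for the exponent `r + 1` replaces the mean value theorem. -/
lemma abs_mul_rpow_sub_le {r : ℝ} (hr : 0 ≤ r) (a b : ℝ) :
    |a * |a| ^ r - b * |b| ^ r| ≤ ((r + 1) * |a| ^ r + (r + 1) * |b| ^ r) * |a - b| := by
  wlog hab : |b| ≤ |a| generalizing a b
  · have := this b a (le_of_not_ge hab)
    rwa [abs_sub_comm, abs_sub_comm b a, add_comm (_ * |b| ^ r)] at this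
  have ha := abs_nonneg a
  have hb := abs_nonneg b
  have h1 : |b| * (|a| ^ r - |b| ^ r) ≤ r * |a| ^ r * |a - b| := by
    have hd : |a| - |b| ≤ |a - b| := abs_sub_abs_le_abs_sub a b
    refine le_trans ?_ (mul_le_mul_of_nonneg_left hd (by positivity))
    rcases ha.eq_or_lt with h0 | h0
    · have hb0 : |b| = 0 := le_antisymm (h0 ▸ hab) hb
      rw [← h0, hb0]; simp
    have hB := one_add_mul_self_le_rpow_one_add (s := |b| / |a| - 1)
      (by have : 0 ≤ |b| / |a| := by positivity
          linarith) (p := r + 1) (by linarith)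
    rw [add_sub_cancel, Real.div_rpow hb ha, Real.rpow_add_one' ha (by linarith),
      Real.rpow_add_one' hb (by linarith), le_div_iff₀ (by positivity)] at hB
    have : (1 + (r + 1) * (|b| / |a| - 1)) * (|a| ^ r * |a|) =
        |a| ^ r * (|a| + (r + 1) * (|b| - |a|)) := by field_simp
    rw [this] at hB
    nlinarith
  have h2 : |a| ^ r - |b| ^ r ≥ 0 := sub_nonneg.2 (Real.rpow_le_rpow hb hab hr)
  have h3 : 0 ≤ |b| ^ r := by positivity
  have h4 := abs_nonneg (a - b)
  calc |a * |a| ^ r - b * |b| ^ r| = |(a - b) * |a| ^ r + b * (|a| ^ r - |b| ^ r)| := by ring_nf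
    _ ≤ |(a - b) * |a| ^ r| + |b * (|a| ^ r - |b| ^ r)| := abs_add_le _ _
    _ = |a - b| * |a| ^ r + |b| * (|a| ^ r - |b| ^ r) := by
        rw [abs_mul, abs_mul, abs_of_nonneg h2, abs_of_nonneg (by positivity : 0 ≤ |a| ^ r)]
    _ ≤ |a - b| * |a| ^ r + r * |a| ^ r * |a - b| := by gcongr
    _ ≤ _ := by
        have : 0 ≤ (r + 1) * |b| ^ r * |a - b| := by positivity
        linarith

/-- Moment inequality for bounded functions of independent variables. -/
theorem integral_abs_rpow_le_of_bddMeas (P : Fin n → Measure E) [∀ i, IsProbabilityMeasure (P i)]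
    {f : (Fin n → E) → ℝ} (hf : BddMeas f) (hf0 : ∫ x, f x ∂(Measure.pi P) = 0) {q : ℝ}
    (hq : 2 ≤ q) :
    (∫ x, |f x| ^ q ∂(Measure.pi P)) ^ (2 / q) ≤ 2 * q *
      (∫ w, sumSqDiff f w ^ (q / 2) ∂((Measure.pi P).prod (Measure.pi P))) ^ (2 / q) := by
  set ν := (Measure.pi P).prod (Measure.pi P) with hν
  have hcont : ∀ p : ℝ, 0 ≤ p → Continuous fun a : ℝ => |a| ^ p := fun p hp =>
    continuous_abs.rpow_const fun _ => Or.inr hp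
  have hVn : ∀ w : (Fin n → E) × (Fin n → E), 0 ≤ sumSqDiff f w := fun w =>
    Finset.sum_nonneg fun _ _ => sq_nonneg _
  have hVq : BddMeas fun w => sumSqDiff f w ^ (q / 2) := by
    have := hf.sumSqDiff.continuous_comp (hcont (q / 2) (by linarith))
    simpa only [abs_of_nonneg (hVn _)] using this
  set X := ∫ x, |f x| ^ q ∂(Measure.pi P) with hX
  set W := ∫ w, sumSqDiff f w ^ (q / 2) ∂ν with hW
  have hX0 : 0 ≤ X := integral_nonneg fun x => by positivity
  have hW0 : 0 ≤ W := integral_nonneg fun w => Real.rpow_nonneg (hVn w) _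
  -- The Hölder exponent `q / (q - 2)` used below degenerates at `q = 2`.
  rcases eq_or_lt_of_le hq with rfl | hq2
  · have := integral_sq_le_of_bddMeas P hf hf0
    simp only [hX, hW, div_self (two_ne_zero' ℝ), Real.rpow_one, Real.rpow_two, sq_abs]
    have h0 : 0 ≤ ∫ w, sumSqDiff f w ∂ν := integral_nonneg hVn
    linarith
  have hHol : ∀ A : Finset (Fin n), ∫ w, ((q - 2 + 1) * |f w.1| ^ (q - 2)) *
      sumSqDiff f (swapOn A w) ∂ν ≤ (q - 1) * (X ^ ((q - 2) / q) * W ^ (2 / q)) := fun A => by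
    have hpq : (q / (q - 2)).HolderConjugate (q / 2) := by
      rw [Real.holderConjugate_iff]
      refine ⟨by rw [lt_div_iff₀ (by linarith)]; linarith, ?_⟩
      field_simp; ring
    have hb1 := hf.fst.continuous_comp (hcont (q - 2) (by linarith))
    have hb2 := hf.sumSqDiff.comp (measurable_swapOn A)
    have memLp : ∀ {F : (Fin n → E) × (Fin n → E) → ℝ}, BddMeas F → ∀ p, MemLp F p ν :=
      fun {F} hF p => by
        obtain ⟨hm, C, hC⟩ := hF
        exact MemLp.of_bound hm.aestronglyMeasurable C (Filter.Eventually.of_forall hC)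
    have := integral_mul_le_Lp_mul_Lq_of_nonneg hpq
      (μ := ν) (f := fun w => |f w.1| ^ (q - 2)) (g := fun w => sumSqDiff f (swapOn A w))
      (Filter.Eventually.of_forall fun w => by positivity)
      (Filter.Eventually.of_forall fun w => hVn _) (memLp hb1 _) (memLp hb2 _)
    have e1 : ∫ w, (|f w.1| ^ (q - 2)) ^ (q / (q - 2)) ∂ν = X := by
      rw [hX, ← integral_prod_fst P fun x => |f x| ^ q]
      refine integral_congr_ae (Filter.Eventually.of_forall fun w => ?_)
      simp only
      rw [← Real.rpow_mul (abs_nonneg _), mul_div_cancel₀ _ (by linarith)]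
    have e2 : ∫ w, sumSqDiff f (swapOn A w) ^ (q / 2) ∂ν = W := hVq.integral_swapOn P A
    rw [e1, e2, one_div_div, one_div_div] at this
    simp only [mul_assoc, integral_const_mul]
    rw [show q - 2 + 1 = q - 1 by ring]
    exact mul_le_mul_of_nonneg_left this (by linarith)
  have key := integral_mul_self_le_of_bddMeas P hf hf0 (h := fun a => a * |a| ^ (q - 2))
    (g := fun a => (q - 2 + 1) * |a| ^ (q - 2))
    (continuous_id.mul (hcont _ (by linarith))) (continuous_const.mul (hcont _ (by linarith)))
    (fun a => mul_nonneg (by linarith) (by positivity))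
    (fun a b => abs_mul_rpow_sub_le (by linarith) a b) hHol
  have e3 : ∫ x, f x * |f x| ^ (q - 2) * f x ∂(Measure.pi P) = X := by
    refine integral_congr_ae (Filter.Eventually.of_forall fun x => ?_)
    simp only
    rw [mul_right_comm, ← abs_mul_abs_self, ← sq, ← Real.rpow_two,
      ← Real.rpow_add' (abs_nonneg _) (by linarith)]
    congr 1; ring
  rw [e3] at key
  -- `X` is on both sides of `key`; when it is positive, dividing by `X ^ ((q - 2) / q)` leaves the
  -- factor `2 (q - 1) ≤ 2 q`.
  rcases hX0.eq_or_lt with h0 | h0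
  · rw [← h0, Real.zero_rpow (by positivity)]; positivity
  have hX2 : X ^ (2 / q) = X / X ^ ((q - 2) / q) := by
    have : (2 : ℝ) / q = 1 - (q - 2) / q := by field_simp; ring
    rw [this, Real.rpow_sub h0, Real.rpow_one]
  rw [hX2, div_le_iff₀ (by positivity)]
  have : 0 ≤ X ^ ((q - 2) / q) * W ^ (2 / q) := by positivity
  nlinarith

end EfronStein

/-! ### The optimal constant of the generalized Efron–Stein inequality -/

section EfronSteinConstant

lemma eLpNorm_ofReal_eq {α : Type*} [MeasurableSpace α] {μ : Measure α} [IsFiniteMeasure μ]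
    {F : α → ℝ} (hF : BddMeas F) {p : ℝ} (hp : 0 < p) :
    eLpNorm F (ENNReal.ofReal p) μ = ENNReal.ofReal ((∫ x, |F x| ^ p ∂μ) ^ p⁻¹) := by
  obtain ⟨hm, C, hC⟩ := hF
  have := (MemLp.of_bound (p := ENNReal.ofReal p) (μ := μ) hm.aestronglyMeasurable C
    (Filter.Eventually.of_forall hC)).eLpNorm_eq_integral_rpow_norm (by simpa using hp) (by simp)
  rw [this, ENNReal.toReal_ofReal hp.le]
  simp only [Real.norm_eq_abs]

variable {n : ℕ} {E : Type*} [MeasurableSpace E]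

lemma eLpNorm_sub_integral_le_of_bddMeas (P : Fin n → Measure E)
    [∀ i, IsProbabilityMeasure (P i)] {f : (Fin n → E) → ℝ} (hf : BddMeas f) {q : ℝ}
    (hq : 2 ≤ q) :
    eLpNorm (fun x => f x - ∫ y, f y ∂(Measure.pi P)) (ENNReal.ofReal q) (Measure.pi P) ≤
      ENNReal.ofReal (√(2 * q)) * (eLpNorm (sumSqDiff f) (ENNReal.ofReal (q / 2))
        ((Measure.pi P).prod (Measure.pi P))) ^ (1 / 2 : ℝ) := by
  set c := ∫ y, f y ∂(Measure.pi P) with hc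
  have hf' : BddMeas fun x => f x - c := hf.sub (BddMeas.const c)
  have h0 : ∫ x, (f x - c) ∂(Measure.pi P) = 0 := by
    rw [integral_sub (hf.integrable _) (integrable_const _)]; simp [hc]
  have hV : sumSqDiff (fun x => f x - c) = sumSqDiff f := by
    funext w; simp [sumSqDiff, coordDiff]
  have key := integral_abs_rpow_le_of_bddMeas P hf' h0 hq
  rw [hV] at key
  rw [eLpNorm_ofReal_eq hf' (by linarith), eLpNorm_ofReal_eq hf.sumSqDiff (by linarith)]
  have hVn : ∀ w : (Fin n → E) × (Fin n → E), |sumSqDiff f w| = sumSqDiff f w := fun w =>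
    abs_of_nonneg (Finset.sum_nonneg fun _ _ => sq_nonneg _)
  simp only [hVn]
  set X := ∫ x, |f x - c| ^ q ∂(Measure.pi P)
  set W := ∫ w, sumSqDiff f w ^ (q / 2) ∂((Measure.pi P).prod (Measure.pi P))
  have hX0 : 0 ≤ X := integral_nonneg fun x => by positivity
  have hW0 : 0 ≤ W := integral_nonneg fun w => by
    rw [Pi.zero_apply, ← hVn]; positivity
  rw [ENNReal.ofReal_rpow_of_nonneg (by positivity) (by norm_num),
    ← ENNReal.ofReal_mul (by positivity), ← Real.sqrt_eq_rpow, ← Real.sqrt_mul (by positivity),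
    inv_div]
  refine ENNReal.ofReal_le_ofReal (Real.le_sqrt_of_sq_le ?_)
  rwa [← Real.rpow_two, ← Real.rpow_mul hX0, inv_mul_eq_div]

/-- Truncation is 1-Lipschitz, so it does not increase the squared increments. The means of the
truncations converge by domination, and Fatou's lemma for `L^q` norms passes to the limit on the
left. -/
lemma eLpNorm_sub_integral_le (P : Fin n → Measure E)
    [∀ i, IsProbabilityMeasure (P i)] {f : (Fin n → E) → ℝ} (hf : Measurable f)
    (hfi : Integrable f (Measure.pi P)) {q : ℝ} (hq : 2 ≤ q) :
    eLpNorm (fun x => f x - ∫ y, f y ∂(Measure.pi P)) (ENNReal.ofReal q) (Measure.pi P) ≤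
      ENNReal.ofReal (√(2 * q)) * (eLpNorm (sumSqDiff f) (ENNReal.ofReal (q / 2))
        ((Measure.pi P).prod (Measure.pi P))) ^ (1 / 2 : ℝ) := by
  let T : ℕ → ℝ → ℝ := fun N a => max (-(N : ℝ)) (min N a)
  have hTm : ∀ N, Measurable (T N) := fun N => by fun_prop
  have hTb : ∀ N a, |T N a| ≤ N := fun N a => by
    have : (0 : ℝ) ≤ N := N.cast_nonneg
    rw [abs_le]
    exact ⟨le_max_left _ _, max_le (by linarith) (min_le_left _ _)⟩
  have hTa : ∀ N a, |T N a| ≤ |a| := fun N a => by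
    have h1 : (0 : ℝ) ≤ N := N.cast_nonneg
    rw [abs_le]
    refine ⟨le_max_of_le_right (le_min ?_ (neg_abs_le a)), max_le ?_ ?_⟩
    · linarith [abs_nonneg a]
    · linarith [abs_nonneg a]
    · exact (min_le_right _ _).trans (le_abs_self a)
  have hTl : ∀ N a b, |T N a - T N b| ≤ |a - b| := fun N a b => by
    refine (abs_max_sub_max_le_max _ _ _ _).trans (max_le (by simp) ?_)
    exact (abs_min_sub_min_le_max _ _ _ _).trans (max_le (by simp) le_rfl)
  have hTe : ∀ (N : ℕ) (a : ℝ), |a| ≤ N → T N a = a := fun N a ha => by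
    have := abs_le.1 ha
    simp only [T]
    rw [min_eq_right this.2, max_eq_right this.1]
  have hTt : ∀ a, Filter.Tendsto (fun N => T N a) Filter.atTop (nhds a) := fun a => by
    refine tendsto_const_nhds.congr' ?_
    obtain ⟨N0, hN0⟩ := exists_nat_ge |a|
    filter_upwards [Filter.eventually_ge_atTop N0] with N hN
    exact (hTe N a (hN0.trans (by exact_mod_cast hN))).symm
  have hfN : ∀ N, BddMeas fun x => T N (f x) := fun N =>
    ⟨(hTm N).comp hf, N, fun x => hTb N _⟩
  have hint : Filter.Tendsto (fun N => ∫ y, T N (f y) ∂(Measure.pi P)) Filter.atTop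
      (nhds (∫ y, f y ∂(Measure.pi P))) :=
    tendsto_integral_of_dominated_convergence (fun x => |f x|)
      (fun N => (hfN N).1.aestronglyMeasurable) hfi.abs
      (fun N => Filter.Eventually.of_forall fun x => hTa N _)
      (Filter.Eventually.of_forall fun x => hTt _)
  refine (Lp.eLpNorm_lim_le_liminf_eLpNorm
    (f := fun N x => T N (f x) - ∫ y, T N (f y) ∂(Measure.pi P))
    (fun N => ((hfN N).1.sub_const _).aestronglyMeasurable) _
    (Filter.Eventually.of_forall fun x => (hTt _).sub hint)).trans ?_
  refine Filter.liminf_le_of_le (by isBoundedDefault) fun b hb => ?_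
  obtain ⟨N, hN⟩ := hb.exists
  refine hN.trans ((eLpNorm_sub_integral_le_of_bddMeas P (hfN N) hq).trans ?_)
  gcongr
  refine eLpNorm_mono fun w => ?_
  unfold sumSqDiff
  rw [Real.norm_of_nonneg (Finset.sum_nonneg fun _ _ => sq_nonneg _),
    Real.norm_of_nonneg (Finset.sum_nonneg fun _ _ => sq_nonneg _)]
  exact Finset.sum_le_sum fun j _ => sq_le_sq.2 (hTl N _ _)

lemma isEfronSteinConstant_one : IsEfronSteinConstant 1 := by
  refine ⟨zero_le_one, fun n E _ P _ f hf hfi q hq => ?_⟩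
  rw [mul_one]
  exact eLpNorm_sub_integral_le P hf hfi hq

/-- Tested on one fair coin with `q = 2`. Positivity of the infimum is what matters, in order to
show that it is attained. -/
lemma IsEfronSteinConstant.one_div_eight_le {κ : ℝ} (h : IsEfronSteinConstant κ) : 1 / 8 ≤ κ := by
  let B : Measure Bool := (2⁻¹ : ENNReal) • (Measure.dirac true + Measure.dirac false)
  have hB : IsProbabilityMeasure B := ⟨by
    simp only [B, Measure.smul_apply, Measure.add_apply, measure_univ, smul_eq_mul]
    rw [one_add_one_eq_two, ENNReal.inv_mul_cancel (by norm_num) (by norm_num)]⟩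
  have hBi : ∀ g : Bool → ℝ, ∫ b, g b ∂B = (g true + g false) / 2 := fun g => by
    have h1 : ∀ b : Bool, Integrable g (Measure.dirac b) := fun b => by
      refine Integrable.of_bound (measurable_of_finite g).aestronglyMeasurable
        (|g true| + |g false|) (Filter.Eventually.of_forall fun b => ?_)
      cases b <;> simp
    rw [integral_smul_measure, integral_add_measure (h1 _) (h1 _), integral_dirac, integral_dirac]
    simp; ring
  let P : Fin 1 → Measure Bool := fun _ => B
  have hmp : MeasurePreserving (fun (b : Bool) (_ : Fin 1) => b) B (Measure.pi P) :=
    (measurePreserving_piUnique (fun _ : Fin 1 => B)).symm _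
  have hpi : ∀ g : (Fin 1 → Bool) → ℝ, ∫ x, g x ∂(Measure.pi P) =
      (g (fun _ => true) + g (fun _ => false)) / 2 := fun g => by
    rw [← hmp.map_eq, integral_map hmp.measurable.aemeasurable
      (measurable_of_finite g).aestronglyMeasurable, hBi]
  let f : (Fin 1 → Bool) → ℝ := fun x => if x 0 then 1 else 0
  have bdd : ∀ {α : Type} [MeasurableSpace α] [Finite α] [MeasurableSingletonClass α] (g : α → ℝ),
      BddMeas g := fun {α} _ _ _ g => by
    cases nonempty_fintype α
    exact ⟨measurable_of_finite g, ∑ a, |g a|, fun a =>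
      Finset.single_le_sum (f := fun a => |g a|) (fun _ _ => abs_nonneg _) (Finset.mem_univ a)⟩
  have key := h.2 1 Bool P f (measurable_of_finite f) ((bdd f).integrable _) 2 le_rfl
  rw [eLpNorm_ofReal_eq (bdd _) two_pos, eLpNorm_ofReal_eq (bdd _) (by norm_num),
    ENNReal.ofReal_rpow_of_nonneg (by positivity) (by norm_num),
    ← ENNReal.ofReal_mul (by positivity), ENNReal.ofReal_le_ofReal_iff (by positivity)] at key
  rw [integral_prod _ ((bdd _).integrable _)] at key
  simp only [hpi, f] at key
  norm_num [Function.update] at key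
  rw [← Real.sqrt_eq_rpow] at key
  have h1 : √2 * √κ * √2 * √(1 / 2) = 2 * √(κ * (1 / 2)) := by
    rw [Real.sqrt_mul h.1, mul_right_comm (√2), Real.mul_self_sqrt two_pos.le, mul_assoc]
  rw [h1] at key
  have h2 := Real.sq_sqrt (mul_nonneg h.1 (by norm_num : (0 : ℝ) ≤ 1 / 2))
  nlinarith

lemma isEfronSteinConstant_efronSteinConstant : IsEfronSteinConstant efronSteinConstant := by
  have hne : {κ : ℝ | IsEfronSteinConstant κ}.Nonempty := ⟨1, isEfronSteinConstant_one⟩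
  have hbd : 1 / 8 ≤ efronSteinConstant := le_csInf hne fun κ h => h.one_div_eight_le
  refine ⟨by linarith, fun n E _ P _ f hf hfi q hq => ?_⟩
  set C := (eLpNorm (fun w : (Fin n → E) × (Fin n → E) =>
    ∑ i, (f w.1 - f (Function.update w.1 i (w.2 i))) ^ 2)
      (ENNReal.ofReal (q / 2)) ((Measure.pi P).prod (Measure.pi P))) ^ (1 / 2 : ℝ)
  -- Multiplication by an infinite `C` is not continuous at `0`, where the product is `0`; the lower
  -- bound on the constant settles this case, and otherwise the inequality is closed in `κ`.
  by_cases hC : C = ⊤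
  · have : 0 < √(2 * efronSteinConstant * q) := Real.sqrt_pos.2 (by
      have : 0 < efronSteinConstant := by linarith
      positivity)
    rw [hC, ENNReal.mul_top (by simpa using this)]
    exact le_top
  obtain ⟨u, -, hu, hmem⟩ := exists_seq_tendsto_sInf hne ⟨0, fun κ h => h.1⟩
  have hlim : Filter.Tendsto (fun N => ENNReal.ofReal (√(2 * u N * q)) * C) Filter.atTop
      (nhds (ENNReal.ofReal (√(2 * efronSteinConstant * q)) * C)) := by
    refine ENNReal.Tendsto.mul_const (ENNReal.tendsto_ofReal ?_) (Or.inr hC)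
    exact ((hu.const_mul 2).mul_const q).sqrt
  exact ge_of_tendsto' hlim fun N => (hmem N).2 n E P f hf hfi q hq

lemma efronSteinConstant_le_one : efronSteinConstant ≤ 1 :=
  csInf_le ⟨0, fun _ h => h.1⟩ isEfronSteinConstant_one

end EfronSteinConstant

/-! ### Stone's lemma -/

section Stone

variable {d : ℕ}

/-- The angle between `a` and `b` is less than 60°, so `2⟪a, b⟫ > ‖a‖ ‖b‖ ≥ ‖a‖²`, and expanding `‖b
- a‖²` concludes. -/
lemma dist_lt_of_norm_sub_lt_one {F : Type*} [NormedAddCommGroup F] [InnerProductSpace ℝ F]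
    {a b : F} (ha : a ≠ 0) (hab : ‖a‖ ≤ ‖b‖) (h : ‖‖a‖⁻¹ • a - ‖b‖⁻¹ • b‖ < 1) :
    ‖b - a‖ < ‖b‖ := by
  have ha' : 0 < ‖a‖ := norm_pos_iff.2 ha
  have hb' : 0 < ‖b‖ := ha'.trans_le hab
  have h1 : ‖‖a‖⁻¹ • a - ‖b‖⁻¹ • b‖ ^ 2 < 1 := by
    have := norm_nonneg (‖a‖⁻¹ • a - ‖b‖⁻¹ • b); nlinarith
  rw [norm_sub_sq_real, norm_smul, norm_smul, norm_inv, norm_norm, norm_inv, norm_norm,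
    inv_mul_cancel₀ ha'.ne', inv_mul_cancel₀ hb'.ne', real_inner_smul_left,
    real_inner_smul_right] at h1
  have h2 : ‖a‖ * ‖b‖ < 2 * inner ℝ a b := by
    have : 1 < 2 * (‖a‖⁻¹ * (‖b‖⁻¹ * inner ℝ a b)) := by linarith
    have h3 := mul_lt_mul_of_pos_right this (mul_pos ha' hb')
    have h4 : 2 * (‖a‖⁻¹ * (‖b‖⁻¹ * inner ℝ a b)) * (‖a‖ * ‖b‖) = 2 * inner ℝ a b := by field_simp
    linarith
  have h3 : ‖b - a‖ ^ 2 < ‖b‖ ^ 2 := by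
    rw [norm_sub_sq_real, real_inner_comm]
    nlinarith
  exact lt_of_pow_lt_pow_left₀ 2 hb'.le h3

/-- For the index `i ∈ I` farthest from `j`, all other members of `I` come before `j` among the
neighbours of `i`; there are fewer than `k` of them. -/
lemma card_le_of_forall_mem_nearestNeighbors {n : ℕ} (x : Fin n → EuclideanSpace ℝ (Fin d))
    (k : ℕ) (j : Fin n) (I : Finset (Fin n))
    (hI : ∀ i ∈ I, i ≠ j ∧ j ∈ nearestNeighbors x (Finset.univ.erase i) k (x i))
    (hd : ∀ i ∈ I, ∀ i' ∈ I, i ≠ i' → dist (x j) (x i') ≤ dist (x j) (x i) →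
      dist (x i) (x i') < dist (x i) (x j)) : I.card ≤ k := by
  rcases I.eq_empty_or_nonempty with rfl | hne
  · simp
  obtain ⟨i, hi, hmax⟩ := I.exists_max_image (fun i => dist (x j) (x i)) hne
  have h1 := (hI i hi).2
  simp only [nearestNeighbors, Finset.mem_filter] at h1
  have h2 : (I.erase i).card < k := by
    refine (Finset.card_le_card fun l hl => ?_).trans_lt h1.2
    have hl' := Finset.mem_erase.1 hl
    simp only [Finset.mem_filter, Finset.mem_erase, Finset.mem_univ, and_true]
    exact ⟨hl'.1, Or.inl (hd i hi l hl'.2 (Ne.symm hl'.1) (hmax l hl'.2))⟩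
  rw [Finset.card_erase_of_mem hi] at h2
  omega

/-- Stone's lemma. -/
lemma exists_isStoneConstant (d : ℕ) : ∃ γ, IsStoneConstant d γ := by
  classical
  obtain ⟨t, -, htf, ht⟩ := (isCompact_sphere (0 : EuclideanSpace ℝ (Fin d)) 1).finite_cover_balls
    (show (0 : ℝ) < 1 / 2 by norm_num)
  lift t to Finset (EuclideanSpace ℝ (Fin d)) using htf
  refine ⟨t.card + 1, by positivity, fun n x hx k j => ?_⟩
  set I := Finset.univ.filter fun i : Fin n =>
    i ≠ j ∧ j ∈ nearestNeighbors x (Finset.univ.erase i) k (x i) with hIdef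
  have hI : ∀ i ∈ I, i ≠ j ∧ j ∈ nearestNeighbors x (Finset.univ.erase i) k (x i) := fun i hi =>
    (Finset.mem_filter.1 hi).2
  let u : Fin n → EuclideanSpace ℝ (Fin d) := fun i => ‖x i - x j‖⁻¹ • (x i - x j)
  let J : EuclideanSpace ℝ (Fin d) → Finset (Fin n) := fun c =>
    I.filter fun i => x i ≠ x j ∧ u i ∈ Metric.ball c (1 / 2)
  have hJ : ∀ c, (J c).card ≤ k := fun c => by
    refine card_le_of_forall_mem_nearestNeighbors x k j (J c)
      (fun i hi => hI i (Finset.mem_filter.1 hi).1) fun i hi i' hi' hne hdist => ?_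
    have h1 := (Finset.mem_filter.1 hi).2
    have h2 := (Finset.mem_filter.1 hi').2
    have := dist_lt_of_norm_sub_lt_one (a := x i' - x j) (b := x i - x j) (sub_ne_zero.2 h2.1)
      (by rwa [dist_comm, dist_comm (x j), dist_eq_norm, dist_eq_norm] at hdist)
      (by
        have h3 := dist_triangle_right (u i') (u i) c
        rw [dist_eq_norm] at h3
        refine h3.trans_lt ?_
        have h4 := Metric.mem_ball.1 h1.2
        have h5 := Metric.mem_ball.1 h2.2
        linarith)
    rwa [sub_sub_sub_cancel_right, ← dist_eq_norm, ← dist_eq_norm] at this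
  -- Points equal to `x j` have no direction. The absence of ties still allows one such point, which
  -- is the reason for the `+ 1` in the constant.
  have h0 : (I.filter fun i => x i = x j).card ≤ k := by
    refine card_le_of_forall_mem_nearestNeighbors x k j _
      (fun i hi => hI i (Finset.mem_filter.1 hi).1) fun i hi i' hi' hne _ => ?_
    obtain ⟨hi1, hi2⟩ := Finset.mem_filter.1 hi
    obtain ⟨hi1', hi2'⟩ := Finset.mem_filter.1 hi'
    exact absurd (by rw [hi2, hi2']) (hx j i i' (hI i hi1).1 (hI i' hi1').1 hne)
  have hsub : I ⊆ t.biUnion J ∪ I.filter fun i => x i = x j := fun i hi => by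
    by_cases hxi : x i = x j
    · exact Finset.mem_union_right _ (Finset.mem_filter.2 ⟨hi, hxi⟩)
    have hu : u i ∈ Metric.sphere (0 : EuclideanSpace ℝ (Fin d)) 1 := by
      rw [mem_sphere_zero_iff_norm, norm_smul, norm_inv, norm_norm,
        inv_mul_cancel₀ (norm_ne_zero_iff.2 (sub_ne_zero.2 hxi))]
    obtain ⟨c, hc, hcu⟩ := Set.mem_iUnion₂.1 (ht hu)
    exact Finset.mem_union_left _ (Finset.mem_biUnion.2
      ⟨c, hc, Finset.mem_filter.2 ⟨hi, hxi, hcu⟩⟩)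
  have hle : I.card ≤ t.card * k + k :=
    (Finset.card_le_card hsub).trans ((Finset.card_union_le _ _).trans
      (add_le_add (Finset.card_biUnion_le_card_mul _ _ _ fun c _ => hJ c) h0))
  calc (I.card : ℝ) ≤ ((t.card * k + k : ℕ) : ℝ) := by exact_mod_cast hle
    _ = _ := by push_cast; ring

lemma isStoneConstant_stoneConstant (d : ℕ) : IsStoneConstant d (stoneConstant d) := by
  have hne : {γ : ℝ | IsStoneConstant d γ}.Nonempty := exists_isStoneConstant d
  refine ⟨Real.sInf_nonneg fun γ h => h.1, fun n x hx k j => ?_⟩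
  obtain ⟨u, -, hu, hmem⟩ := exists_seq_tendsto_sInf hne ⟨0, fun γ h => h.1⟩
  exact ge_of_tendsto' (hu.const_mul (k : ℝ)) fun N => (hmem N).2 n x hx k j

/-- Two points are each other's nearest neighbour, and no tie is possible with only two indices;
they may coincide, so this covers dimension 0. The bound lets `γ` absorb additive constants later.
-/
lemma one_le_stoneConstant (d : ℕ) : 1 ≤ stoneConstant d := by
  have h := (isStoneConstant_stoneConstant d).2 2 (fun _ => 0)
    (fun i j l h1 h2 h3 => absurd h3 (by omega)) 1 0
  rw [Nat.cast_one, one_mul] at h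
  refine le_trans ?_ h
  rw [Nat.one_le_cast, Nat.one_le_iff_ne_zero, ← Nat.pos_iff_ne_zero, Finset.card_pos]
  refine ⟨1, ?_⟩
  simp only [nearestNeighbors, Finset.mem_filter, Finset.mem_univ, Finset.mem_erase]
  refine ⟨trivial, by decide, ⟨by decide, trivial⟩, ?_⟩
  rw [Nat.lt_one_iff, Finset.card_eq_zero, Finset.filter_eq_empty_iff]
  intro l _
  simp

end Stone

/-! ### Effect of removing one point on neighbours and votes -/

section NearestNeighbors

variable {d n : ℕ}

/-- `j` comes before `i` in the order by distance to `u`, ties being broken by the index. -/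
def Closer (x : Fin n → EuclideanSpace ℝ (Fin d)) (u : EuclideanSpace ℝ (Fin d)) (j i : Fin n) :
    Prop :=
  dist u (x j) < dist u (x i) ∨ (dist u (x j) = dist u (x i) ∧ j < i)

open Classical in
/-- The number of indices in `e` which come before `i`. -/
noncomputable def distRank (x : Fin n → EuclideanSpace ℝ (Fin d)) (e : Finset (Fin n))
    (u : EuclideanSpace ℝ (Fin d)) (i : Fin n) : ℕ :=
  (e.filter fun j => Closer x u j i).card

variable {x : Fin n → EuclideanSpace ℝ (Fin d)} {u : EuclideanSpace ℝ (Fin d)}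
  {e : Finset (Fin n)} {k : ℕ} {i j l : Fin n}

lemma Closer.irrefl : ¬ Closer x u i i := by simp [Closer]

lemma Closer.trans (h : Closer x u i j) (h' : Closer x u j l) : Closer x u i l := by
  rcases h with h | ⟨h, h1⟩ <;> rcases h' with h' | ⟨h', h2⟩
  · exact Or.inl (h.trans h')
  · exact Or.inl (h' ▸ h)
  · exact Or.inl (h ▸ h')
  · exact Or.inr ⟨h.trans h', h1.trans h2⟩

lemma closer_or_closer (h : i ≠ j) : Closer x u i j ∨ Closer x u j i := by
  rcases lt_trichotomy (dist u (x i)) (dist u (x j)) with h1 | h1 | h1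
  · exact Or.inl (Or.inl h1)
  · rcases lt_or_gt_of_ne h with h2 | h2
    · exact Or.inl (Or.inr ⟨h1, h2⟩)
    · exact Or.inr (Or.inr ⟨h1.symm, h2⟩)
  · exact Or.inr (Or.inl h1)

lemma mem_nearestNeighbors : i ∈ nearestNeighbors x e k u ↔ i ∈ e ∧ distRank x e u i < k := by
  classical
  rw [nearestNeighbors, Finset.mem_filter, distRank]
  convert Iff.rfl using 4
  ext
  simp only [Finset.mem_filter]
  rfl

lemma nearestNeighbors_subset : nearestNeighbors x e k u ⊆ e := Finset.filter_subset _ _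

lemma distRank_lt (hj : j ∈ e) (h : Closer x u j i) : distRank x e u j < distRank x e u i := by
  classical
  refine Finset.card_lt_card (Finset.ssubset_iff_of_subset ?_ |>.2 ⟨j, ?_, ?_⟩)
  · intro l hl
    rw [Finset.mem_filter] at hl ⊢
    exact ⟨hl.1, hl.2.trans h⟩
  · exact Finset.mem_filter.2 ⟨hj, h⟩
  · exact fun h' => Closer.irrefl (Finset.mem_filter.1 h').2

lemma closer_of_distRank_lt (hj : j ∈ e) (h : distRank x e u i < distRank x e u j) :
    Closer x u i j :=
  (closer_or_closer fun hij => by simp [hij] at h).resolve_right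
    fun h' => (distRank_lt hj h').not_gt h

lemma distRank_lt_card (hi : i ∈ e) : distRank x e u i < e.card := by
  classical
  exact Finset.card_lt_card (Finset.filter_ssubset.2 ⟨i, hi, Closer.irrefl⟩)

lemma distRank_injOn : Set.InjOn (distRank x e u) e := fun i hi j hj h => by
  by_contra hne
  rcases closer_or_closer (x := x) (u := u) hne with h' | h'
  · exact (distRank_lt hi h').ne h
  · exact (distRank_lt hj h').ne h.symm

lemma image_distRank : e.image (distRank x e u) = Finset.range e.card :=
  Finset.eq_of_subset_of_card_le
    (Finset.image_subset_iff.2 fun _ hi => Finset.mem_range.2 (distRank_lt_card hi))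
    (by rw [Finset.card_image_of_injOn distRank_injOn, Finset.card_range])

lemma card_nearestNeighbors_le : (nearestNeighbors x e k u).card ≤ k := by
  rw [← Finset.card_image_of_injOn (distRank_injOn.mono (Finset.coe_subset.2
    (nearestNeighbors_subset (x := x) (u := u) (e := e) (k := k))))]
  refine (Finset.card_le_card ?_).trans_eq (Finset.card_range k)
  exact (Finset.image_subset_iff.2 fun i hi =>
    Finset.mem_range.2 (mem_nearestNeighbors.1 hi).2)

lemma card_nearestNeighbors (h : k ≤ e.card) : (nearestNeighbors x e k u).card = k := by
  refine le_antisymm card_nearestNeighbors_le ?_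
  conv_lhs => rw [← Finset.card_range k]
  refine (Finset.card_le_card fun t ht => ?_).trans
    (Finset.card_image_le (f := distRank x e u))
  have ht' : t ∈ e.image (distRank x e u) := by
    rw [image_distRank, Finset.mem_range]
    exact (Finset.mem_range.1 ht).trans_le h
  obtain ⟨i, hi, rfl⟩ := Finset.mem_image.1 ht'
  exact Finset.mem_image_of_mem _ (mem_nearestNeighbors.2 ⟨hi, Finset.mem_range.1 ht⟩)

open Classical in
lemma distRank_erase (hi : i ∈ e) :
    distRank x (e.erase i) u l + (if Closer x u i l then 1 else 0) = distRank x e u l := by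
  rw [distRank, distRank, Finset.filter_erase]
  split_ifs with h
  · exact Finset.card_erase_add_one (Finset.mem_filter.2 ⟨hi, h⟩)
  · rw [Finset.erase_eq_of_notMem (by simp [h]), add_zero]

lemma nearestNeighbors_erase_of_notMem (hi : i ∈ e) (h : i ∉ nearestNeighbors x e k u) :
    nearestNeighbors x (e.erase i) k u = nearestNeighbors x e k u := by
  classical
  have hik : k ≤ distRank x e u i := not_lt.1 fun h' => h (mem_nearestNeighbors.2 ⟨hi, h'⟩)
  ext l
  have hl := distRank_erase (x := x) (u := u) (l := l) hi
  simp only [mem_nearestNeighbors, Finset.mem_erase]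
  constructor
  · rintro ⟨⟨-, hle⟩, h2⟩
    refine ⟨hle, ?_⟩
    split_ifs at hl with hc
    · have := distRank_lt hi hc; omega
    · omega
  · rintro ⟨hle, h2⟩
    exact ⟨⟨fun hli => by subst hli; omega, hle⟩, by split_ifs at hl <;> omega⟩

/-- When a neighbour leaves, the `(k + 1)`-th nearest point takes the free place. Writing the result
inside the `k + 1` nearest points of `e` makes the tightness condition independent of which
neighbour is removed. -/
lemma nearestNeighbors_erase_of_mem (h : i ∈ nearestNeighbors x e k u) :
    nearestNeighbors x (e.erase i) k u = (nearestNeighbors x e (k + 1) u).erase i := by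
  classical
  obtain ⟨hi, hik⟩ := mem_nearestNeighbors.1 h
  ext l
  have hl := distRank_erase (x := x) (u := u) (l := l) hi
  simp only [mem_nearestNeighbors, Finset.mem_erase]
  constructor
  · rintro ⟨⟨hli, hle⟩, h2⟩
    exact ⟨hli, hle, by split_ifs at hl <;> omega⟩
  · rintro ⟨hli, hle, h2⟩
    refine ⟨⟨hli, hle⟩, ?_⟩
    split_ifs at hl with hc
    · omega
    · have := distRank_lt hle ((closer_or_closer hli).resolve_right hc)
      omega

lemma nearestNeighbors_congr {y : Fin n → EuclideanSpace ℝ (Fin d)} (h : ∀ i ∈ e, x i = y i) :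
    nearestNeighbors x e k u = nearestNeighbors y e k u := by
  classical
  unfold nearestNeighbors
  refine Finset.filter_congr fun i hi => ?_
  have : ∀ j ∈ e, (dist u (x j) < dist u (x i) ∨ (dist u (x j) = dist u (x i) ∧ j < i)) ↔
      (dist u (y j) < dist u (y i) ∨ (dist u (y j) = dist u (y i) ∧ j < i)) := fun j hj => by
    rw [h i hi, h j hj]
  rw [Finset.filter_congr this]

lemma closer_of_nearestNeighbors_eq {T : Finset (Fin n)} (h : nearestNeighbors x e k u = T)
    (hi : i ∈ T) (hj : j ∈ e \ T) : Closer x u i j := by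
  obtain ⟨hje, hjT⟩ := Finset.mem_sdiff.1 hj
  rw [← h, mem_nearestNeighbors] at hi hjT
  exact closer_of_distRank_lt hje (by tauto |> fun h' : ¬ _ < k => by omega)

lemma nearestNeighbors_eq_of_dist_lt {T : Finset (Fin n)} (hT : T ⊆ e) (hk : T.card = k)
    (h : ∀ i ∈ T, ∀ j ∈ e \ T, dist u (x i) < dist u (x j)) : nearestNeighbors x e k u = T := by
  classical
  refine (Finset.eq_of_subset_of_card_le (fun i hi => ?_)
    (hk ▸ card_nearestNeighbors_le)).symm
  refine mem_nearestNeighbors.2 ⟨hT hi, ?_⟩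
  rw [← hk]
  refine Finset.card_lt_card ((Finset.ssubset_iff_of_subset fun j hj => ?_).2
    ⟨i, hi, fun h' => Closer.irrefl (Finset.mem_filter.1 h').2⟩)
  obtain ⟨hje, hj⟩ := Finset.mem_filter.1 hj
  by_contra hjT
  have := h i hi j (Finset.mem_sdiff.2 ⟨hje, hjT⟩)
  rcases hj with hj | ⟨hj, -⟩ <;> linarith

/-- The number of indices in `S` with label `1`. -/
def numOnes (z : Fin n → EuclideanSpace ℝ (Fin d) × Bool) (S : Finset (Fin n)) : ℕ :=
  (S.filter fun l => (z l).2 = true).card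

variable {z z' : Fin n → EuclideanSpace ℝ (Fin d) × Bool}

lemma numOnes_mono {S T : Finset (Fin n)} (h : S ⊆ T) : numOnes z S ≤ numOnes z T :=
  Finset.card_le_card (Finset.filter_subset_filter _ h)

lemma numOnes_le_add {S T : Finset (Fin n)} (h : S ⊆ T) (hc : T.card ≤ S.card + 1) :
    numOnes z T ≤ numOnes z S + 1 := by
  have h1 : numOnes z T ≤ numOnes z S + numOnes z (T \ S) := by
    conv_lhs => rw [← Finset.union_sdiff_of_subset h]
    rw [numOnes, Finset.filter_union]
    exact Finset.card_union_le _ _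
  have h2 : numOnes z (T \ S) ≤ (T \ S).card := Finset.card_filter_le _ _
  have h3 := Finset.card_sdiff_add_card_eq_card h
  omega

lemma knnClassifier_eq_true_iff (hk : 1 ≤ k) :
    knnClassifier k e z u = true ↔
      k < 2 * numOnes z (nearestNeighbors (fun i => (z i).1) e k u) := by
  have hk' : (0 : ℝ) < k := by exact_mod_cast hk
  have h1 : ∑ i ∈ nearestNeighbors (fun i => (z i).1) e k u, (if (z i).2 = true then (1 : ℝ) else 0)
      = numOnes z (nearestNeighbors (fun i => (z i).1) e k u) := by
    rw [numOnes, Finset.sum_boole]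
  rw [knnClassifier, h1]
  simp only [ite_eq_left_iff, Bool.false_eq_true, imp_false, not_not]
  rw [one_div_mul_eq_div, div_lt_div_iff₀ two_pos hk', one_mul, mul_comm]
  exact_mod_cast Iff.rfl

lemma knnClassifier_congr (h : ∀ i ∈ e, z i = z' i) :
    knnClassifier k e z u = knnClassifier k e z' u := by
  have h1 : nearestNeighbors (fun i => (z i).1) e k u = nearestNeighbors (fun i => (z' i).1) e k u :=
    nearestNeighbors_congr fun i hi => by rw [h i hi]
  have h2 : ∑ i ∈ nearestNeighbors (fun i => (z' i).1) e k u, (if (z i).2 = true then (1 : ℝ) else 0)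
      = ∑ i ∈ nearestNeighbors (fun i => (z' i).1) e k u, (if (z' i).2 = true then (1 : ℝ) else 0) :=
    Finset.sum_congr rfl fun i hi => by rw [h i (nearestNeighbors_subset hi)]
  rw [knnClassifier, knnClassifier, h1, h2]

/-- If removing an index changes the classifier then this index is among the `k` nearest
neighbours, and the vote among the `k + 1` nearest ones is tight. -/
lemma mem_and_numOnes_eq_of_knnClassifier_ne (hk : 1 ≤ k) (hi : i ∈ e) (hke : k + 1 ≤ e.card)
    (h : knnClassifier k e z u ≠ knnClassifier k (e.erase i) z u) :
    i ∈ nearestNeighbors (fun i => (z i).1) e k u ∧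
      numOnes z (nearestNeighbors (fun i => (z i).1) e (k + 1) u) = k / 2 + 1 := by
  rw [Ne, Bool.eq_iff_iff, knnClassifier_eq_true_iff hk, knnClassifier_eq_true_iff hk] at h
  have hmem : i ∈ nearestNeighbors (fun i => (z i).1) e k u := by
    by_contra h'
    exact h (by rw [nearestNeighbors_erase_of_notMem hi h'])
  refine ⟨hmem, ?_⟩
  rw [nearestNeighbors_erase_of_mem hmem] at h
  have hsub : nearestNeighbors (fun i => (z i).1) e k u ⊆
      nearestNeighbors (fun i => (z i).1) e (k + 1) u := fun l hl => by
    rw [mem_nearestNeighbors] at hl ⊢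
    exact ⟨hl.1, by omega⟩
  have hc1 := card_nearestNeighbors (x := fun i => (z i).1) (u := u) (Nat.le_of_succ_le hke)
  have hc2 := card_nearestNeighbors (x := fun i => (z i).1) (u := u) hke
  have h1 := numOnes_mono (z := z) hsub
  have h2 := numOnes_le_add (z := z) hsub (by omega)
  have h3 := numOnes_mono (z := z) (Finset.erase_subset i
    (nearestNeighbors (fun i => (z i).1) e (k + 1) u))
  have h4 := numOnes_le_add (z := z) (Finset.erase_subset i
    (nearestNeighbors (fun i => (z i).1) e (k + 1) u))
    (by rw [Finset.card_erase_of_mem (hsub hmem)]; omega)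
  -- If `N` is the number of labels 1 among the `k + 1` nearest points, both votes count `N` or `N -
  -- 1`; they disagree only if `N - 1 ≤ ⌊k/2⌋ < N`.
  omega

end NearestNeighbors

/-! ### Anticoncentration of a binomial count -/

section Binomial

lemma centralBinom_sq_mul_le (s : ℕ) : s.centralBinom ^ 2 * (2 * s + 1) ≤ 16 ^ s := by
  induction s with
  | zero => simp
  | succ s ih =>
    have h := Nat.succ_mul_centralBinom_succ s
    refine Nat.le_of_mul_le_mul_left (c := (s + 1) ^ 2) ?_ (by positivity)
    calc (s + 1) ^ 2 * ((s + 1).centralBinom ^ 2 * (2 * (s + 1) + 1))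
        = ((s + 1) * (s + 1).centralBinom) ^ 2 * (2 * s + 3) := by ring
      _ = (s.centralBinom ^ 2 * (2 * s + 1)) * (4 * ((2 * s + 1) * (2 * s + 3))) := by rw [h]; ring
      _ ≤ 16 ^ s * (16 * (s + 1) ^ 2) := by
          refine Nat.mul_le_mul ih ?_
          nlinarith
      _ = (s + 1) ^ 2 * 16 ^ (s + 1) := by ring

lemma centralBinom_le_div_sqrt (s : ℕ) : (s.centralBinom : ℝ) ≤ 4 ^ s / √(2 * s + 1) := by
  rw [le_div_iff₀ (by positivity)]
  refine (sq_le_sq₀ (by positivity) (by positivity)).1 ?_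
  rw [mul_pow, Real.sq_sqrt (by positivity), ← pow_mul, mul_comm s 2, pow_mul]
  have := centralBinom_sq_mul_le s
  norm_num
  exact_mod_cast this

/-- A central binomial probability, written without normalising `a + b = 1`. Combine `4ab ≤ (a +
b)²` with the bound on central binomial coefficients; for even `k` the coefficient is half of a
central one. -/
lemma choose_mul_pow_mul_pow_le (k : ℕ) {a b : ℝ} (ha : 0 ≤ a) (hb : 0 ≤ b) :
    ((k + 1).choose (k / 2 + 1) : ℝ) * (a ^ (k / 2 + 1) * b ^ (k + 1 - (k / 2 + 1))) ≤
      2 / √(k + 1) * (a + b) ^ (k + 1) := by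
  have hab : 4 * (a * b) ≤ (a + b) ^ 2 := by nlinarith [sq_nonneg (a - b)]
  have hpow : ∀ t : ℕ, 4 ^ t * (a * b) ^ t ≤ (a + b) ^ (2 * t) := fun t => by
    rw [← mul_pow, pow_mul]
    exact pow_le_pow_left₀ (by positivity) hab t
  obtain ⟨t, rfl | rfl⟩ := Nat.even_or_odd' k
  · have h1 : 2 * t / 2 = t := by omega
    have h2 : 2 * t + 1 - (t + 1) = t := by omega
    rw [h1, h2]
    have hc : 2 * ((2 * t + 1).choose (t + 1) : ℝ) = (t + 1).centralBinom := by
      have : (t + 1).centralBinom = 2 * (2 * t + 1).choose (t + 1) := by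
        rw [Nat.centralBinom, show 2 * (t + 1) = (2 * t + 1) + 1 by ring, Nat.choose_succ_succ,
          Nat.choose_symm_half]
        ring
      rw [this]; push_cast; ring
    have hcb := centralBinom_le_div_sqrt (t + 1)
    rw [← hc, pow_succ (4 : ℝ)] at hcb
    calc ((2 * t + 1).choose (t + 1) : ℝ) * (a ^ (t + 1) * b ^ t)
        ≤ 2 * (4 ^ t / √(2 * (t + 1 : ℕ) + 1)) * (a ^ (t + 1) * b ^ t) := by
          gcongr
          have : (4 : ℝ) ^ t * 4 / √(2 * (t + 1 : ℕ) + 1) =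
            4 * (4 ^ t / √(2 * (t + 1 : ℕ) + 1)) := by ring
          linarith
      _ = 2 / √(2 * (t + 1 : ℕ) + 1) * (a * (4 ^ t * (a * b) ^ t)) := by ring
      _ ≤ 2 / √((2 * t : ℕ) + 1) * ((a + b) * (a + b) ^ (2 * t)) := by
          gcongr
          · push_cast; linarith
          · linarith
          · exact hpow t
      _ = _ := by ring
  · have h1 : (2 * t + 1) / 2 = t := by omega
    have h2 : 2 * t + 1 + 1 - (t + 1) = t + 1 := by omega
    rw [h1, h2]
    have hcb := centralBinom_le_div_sqrt (t + 1)
    rw [Nat.centralBinom, show 2 * (t + 1) = 2 * t + 1 + 1 by ring] at hcb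
    calc ((2 * t + 1 + 1).choose (t + 1) : ℝ) * (a ^ (t + 1) * b ^ (t + 1))
        ≤ 4 ^ (t + 1) / √(2 * (t + 1 : ℕ) + 1) * (a ^ (t + 1) * b ^ (t + 1)) := by gcongr
      _ = 1 / √(2 * (t + 1 : ℕ) + 1) * (4 ^ (t + 1) * (a * b) ^ (t + 1)) := by ring
      _ ≤ 2 / √((2 * t + 1 : ℕ) + 1) * (a + b) ^ (2 * (t + 1)) := by
          gcongr
          · norm_num
          · push_cast; linarith
          · exact hpow (t + 1)
      _ = _ := by ring

/-- For i.i.d. labelled points in a region, the number of labels `1` is unlikely to be tight. -/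
lemma pi_numOnes_eq_le {X ι : Type*} [MeasurableSpace X] [Fintype ι] [DecidableEq ι]
    (P : Measure (X × Bool)) [IsProbabilityMeasure P] (B : Set X) (hB : MeasurableSet B) {k : ℕ}
    (hι : Fintype.card ι = k + 1) :
    Measure.pi (fun _ : ι => P) {t | (∀ l, (t l).1 ∈ B) ∧
        (Finset.univ.filter fun l => (t l).2 = true).card = k / 2 + 1} ≤
      ENNReal.ofReal (2 / √(k + 1)) * Measure.pi (fun _ : ι => P) {t | ∀ l, (t l).1 ∈ B} := by
  let R : Finset ι → ι → Set (X × Bool) := fun S l => B ×ˢ {decide (l ∈ S)}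
  -- The event is split according to the set `S` of indices with label 1; each piece is a box of
  -- measure `a ^ |S| * b ^ (k + 1 - |S|)`.
  have hcover : {t : ι → X × Bool | (∀ l, (t l).1 ∈ B) ∧
      (Finset.univ.filter fun l => (t l).2 = true).card = k / 2 + 1} ⊆
      ⋃ S ∈ (Finset.univ : Finset ι).powersetCard (k / 2 + 1), Set.univ.pi (R S) := by
    rintro t ⟨h1, h2⟩
    refine Set.mem_iUnion₂.2 ⟨Finset.univ.filter fun l => (t l).2 = true,
      Finset.mem_powersetCard.2 ⟨Finset.subset_univ _, h2⟩, fun l _ => ⟨h1 l, ?_⟩⟩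
    simp
  set a := P (B ×ˢ {true})
  set b := P (B ×ˢ {false})
  have hR : ∀ S ∈ (Finset.univ : Finset ι).powersetCard (k / 2 + 1),
      Measure.pi (fun _ : ι => P) (Set.univ.pi (R S)) =
        a ^ (k / 2 + 1) * b ^ (k + 1 - (k / 2 + 1)) := fun S hS => by
    have hSc := (Finset.mem_powersetCard.1 hS).2
    rw [Measure.pi_pi]
    have : ∀ l, P (R S l) = if l ∈ S then a else b := fun l => by
      by_cases h : l ∈ S <;> simp [R, h, a, b]
    simp only [this]
    rw [Finset.prod_ite, Finset.prod_const, Finset.prod_const, Finset.filter_mem_eq_inter,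
      Finset.univ_inter, Finset.filter_notMem_eq_sdiff, Finset.card_univ_sdiff, hι, hSc]
  have hab : P (B ×ˢ Set.univ) = a + b := by
    rw [← measure_union (Set.disjoint_left.2 (by rintro ⟨x, y⟩ ⟨-, h⟩ ⟨-, h'⟩; simp_all))
      (hB.prod (measurableSet_singleton _)), ← Set.prod_union]
    congr 2
    ext y; cases y <;> simp
  have hright : Measure.pi (fun _ : ι => P) {t | ∀ l, (t l).1 ∈ B} = (a + b) ^ (k + 1) := by
    have : {t : ι → X × Bool | ∀ l, (t l).1 ∈ B} = Set.univ.pi fun _ => B ×ˢ Set.univ := by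
      ext t; simp
    rw [this, Measure.pi_pi, hab, Finset.prod_const, Finset.card_univ, hι]
  rw [hright]
  refine (measure_mono hcover).trans ((measure_biUnion_finset_le _ _).trans ?_)
  rw [Finset.sum_congr rfl hR, Finset.sum_const, Finset.card_powersetCard, Finset.card_univ, hι]
  have ha : a ≠ ⊤ := measure_ne_top _ _
  have hb : b ≠ ⊤ := measure_ne_top _ _
  clear_value a b
  lift a to NNReal using ha
  lift b to NNReal using hb
  rw [nsmul_eq_mul, ← ENNReal.ofReal_coe_nnreal, ← ENNReal.ofReal_coe_nnreal (p := b),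
    ← ENNReal.ofReal_natCast, ← ENNReal.ofReal_add (by positivity) (by positivity),
    ← ENNReal.ofReal_pow (by positivity), ← ENNReal.ofReal_pow (by positivity),
    ← ENNReal.ofReal_pow (by positivity), ← ENNReal.ofReal_mul (by positivity),
    ← ENNReal.ofReal_mul (by positivity), ← ENNReal.ofReal_mul (by positivity)]
  exact ENNReal.ofReal_le_ofReal (choose_mul_pow_mul_pow_le k a.2 b.2)

end Binomial

/-! ### Measurability of votes and probability of a tight vote -/

section VoteMeasurability

variable {d m : ℕ}

lemma measurableSet_closer (i j l : Fin m) :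
    MeasurableSet {z : Fin m → EuclideanSpace ℝ (Fin d) × Bool |
      Closer (fun i => (z i).1) (z j).1 l i} := by
  have h1 : ∀ l, Measurable fun z : Fin m → EuclideanSpace ℝ (Fin d) × Bool =>
      dist (z j).1 (z l).1 := fun l => by fun_prop
  exact (measurableSet_lt (h1 l) (h1 i)).union
    ((measurableSet_eq_fun (h1 l) (h1 i)).inter (MeasurableSet.const _))

lemma measurableSet_mem_nearestNeighbors (e : Finset (Fin m)) (k : ℕ) (i j : Fin m) :
    MeasurableSet {z : Fin m → EuclideanSpace ℝ (Fin d) × Bool |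
      i ∈ nearestNeighbors (fun i => (z i).1) e k (z j).1} := by
  classical
  have h1 : Measurable fun z : Fin m → EuclideanSpace ℝ (Fin d) × Bool =>
      distRank (fun i => (z i).1) e (z j).1 i := by
    simp only [distRank, Finset.card_filter]
    exact Finset.measurable_fun_sum _ fun l _ =>
      Measurable.ite (measurableSet_closer i j l) measurable_const measurable_const
  simp only [mem_nearestNeighbors]
  exact (MeasurableSet.const _).inter (h1 (measurableSet_Iio (a := k)))

lemma measurable_numOnes_nearestNeighbors (e : Finset (Fin m)) (k : ℕ) (j : Fin m) :
    Measurable fun z : Fin m → EuclideanSpace ℝ (Fin d) × Bool =>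
      numOnes z (nearestNeighbors (fun i => (z i).1) e k (z j).1) := by
  classical
  have : ∀ z : Fin m → EuclideanSpace ℝ (Fin d) × Bool,
      numOnes z (nearestNeighbors (fun i => (z i).1) e k (z j).1) =
        ∑ l, if l ∈ nearestNeighbors (fun i => (z i).1) e k (z j).1 ∧ (z l).2 = true
          then 1 else 0 := fun z => by
    rw [numOnes, ← Finset.card_filter]
    congr 1
    ext l; simp
  simp only [this]
  refine Finset.measurable_fun_sum _ fun l _ =>
    Measurable.ite ((measurableSet_mem_nearestNeighbors e k l j).inter ?_) measurable_const
      measurable_const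
  exact measurableSet_eq_fun (by fun_prop) measurable_const

lemma measurable_knnClassifier {k : ℕ} (hk : 1 ≤ k) (e : Finset (Fin m)) (j : Fin m) :
    Measurable fun z : Fin m → EuclideanSpace ℝ (Fin d) × Bool =>
      knnClassifier k e z (z j).1 := by
  refine measurable_to_bool ?_
  have : (fun z : Fin m → EuclideanSpace ℝ (Fin d) × Bool => knnClassifier k e z (z j).1) ⁻¹'
      {true} = {z | k < 2 * numOnes z (nearestNeighbors (fun i => (z i).1) e k (z j).1)} := by
    ext z
    simp [knnClassifier_eq_true_iff hk]
  rw [this]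
  exact measurableSet_lt measurable_const
    ((measurable_numOnes_nearestNeighbors e k j).const_mul 2)

/-- The set of samples for which the indices in `T` are strictly closer to the point `j` than the
other ones. -/
def closestSet (d : ℕ) (j : Fin m) (T : Finset (Fin m)) :
    Set (Fin m → EuclideanSpace ℝ (Fin d) × Bool) :=
  {z | ∀ i ∈ T, ∀ l ∈ Finset.univ.erase j \ T, dist (z j).1 (z i).1 < dist (z j).1 (z l).1}

lemma measurableSet_closestSet (j : Fin m) (T : Finset (Fin m)) :
    MeasurableSet (closestSet d j T) := by
  have h1 : ∀ l, Measurable fun z : Fin m → EuclideanSpace ℝ (Fin d) × Bool =>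
      dist (z j).1 (z l).1 := fun l => by fun_prop
  simp only [closestSet, Set.ofPred_forall]
  exact Finset.measurableSet_biInter _ fun i _ => Finset.measurableSet_biInter _ fun l _ =>
    measurableSet_lt (h1 i) (h1 l)

lemma measurable_numOnes (T : Finset (Fin m)) :
    Measurable fun z : Fin m → EuclideanSpace ℝ (Fin d) × Bool => numOnes z T := by
  simp only [numOnes, Finset.card_filter]
  exact Finset.measurable_fun_sum _ fun l _ => Measurable.ite
    (measurableSet_eq_fun (by fun_prop) measurable_const) measurable_const measurable_const

variable (P : Measure (EuclideanSpace ℝ (Fin d) × Bool)) [IsProbabilityMeasure P]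

/-- Fubini, freezing the points `v` outside `T`, including the point `j`. Being closest then means
that all points of `T` lie in a region `B` determined by `v`, so the binomial bound applies for each
`v`. -/
lemma pi_closestSet_inter_le (j : Fin m) {T : Finset (Fin m)} (hjT : j ∉ T) {k : ℕ}
    (hT : T.card = k + 1) :
    Measure.pi (fun _ : Fin m => P) (closestSet d j T ∩ {z | numOnes z T = k / 2 + 1}) ≤
      ENNReal.ofReal (2 / √(k + 1)) * Measure.pi (fun _ : Fin m => P) (closestSet d j T) := by
  have hmp := (measurePreserving_piEquivPiSubtypeProd (fun _ : Fin m => P) (· ∈ T)).symm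
  have hG := measurableSet_closestSet (d := d) j T
  have hN : MeasurableSet {z : Fin m → EuclideanSpace ℝ (Fin d) × Bool |
      numOnes z T = k / 2 + 1} := measurableSet_eq_fun (measurable_numOnes T) measurable_const
  set φ := (MeasurableEquiv.piEquivPiSubtypeProd
    (fun _ : Fin m => EuclideanSpace ℝ (Fin d) × Bool) (· ∈ T)).symm with hφ
  rw [← hmp.measure_preimage (hG.inter hN).nullMeasurableSet,
    ← hmp.measure_preimage hG.nullMeasurableSet,
    Measure.prod_apply_symm (φ.measurable (hG.inter hN)), Measure.prod_apply_symm (φ.measurable hG),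
    ← lintegral_const_mul _ (measurable_measure_prodMk_right (φ.measurable hG))]
  refine lintegral_mono fun v => ?_
  have hin : ∀ t i (h : i ∈ T), φ (t, v) i = t ⟨i, h⟩ := fun t i h => by
    simp [hφ, MeasurableEquiv.piEquivPiSubtypeProd, Equiv.piEquivPiSubtypeProd, h]
  have hout : ∀ t i (h : i ∉ T), φ (t, v) i = v ⟨i, h⟩ := fun t i h => by
    simp [hφ, MeasurableEquiv.piEquivPiSubtypeProd, Equiv.piEquivPiSubtypeProd, h]
  let u := (v ⟨j, hjT⟩).1
  let B : Set (EuclideanSpace ℝ (Fin d)) :=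
    {x | ∀ l : {l // l ∉ T}, (l : Fin m) ≠ j → dist u x < dist u (v l).1}
  have hB : MeasurableSet B := by
    simp only [B, Set.ofPred_forall]
    exact MeasurableSet.iInter fun l => MeasurableSet.iInter fun _ =>
      measurableSet_lt (by fun_prop) measurable_const
  have e1 : ∀ t, φ (t, v) ∈ closestSet d j T ↔ ∀ l, (t l).1 ∈ B := fun t => by
    simp only [closestSet, Set.mem_ofPred_eq, Finset.mem_sdiff, Finset.mem_erase, Finset.mem_univ,
      and_true, B, hout t j hjT]
    constructor
    · rintro h ⟨i, hi⟩ ⟨l, hl⟩ hlj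
      have := h i hi l ⟨hlj, hl⟩
      rwa [hin t i hi, hout t l hl] at this
    · rintro h i hi l ⟨hlj, hl⟩
      rw [hin t i hi, hout t l hl]
      exact h ⟨i, hi⟩ ⟨l, hl⟩ hlj
  have e2 : ∀ t, numOnes (φ (t, v)) T = (Finset.univ.filter fun l => (t l).2 = true).card :=
    fun t => by
      rw [numOnes, Finset.card_filter, Finset.card_filter, ← Finset.sum_coe_sort]
      exact Finset.sum_congr rfl fun l _ => by rw [hin t l l.2]
  have key := pi_numOnes_eq_le P B hB (k := k) (ι := {l // l ∈ T}) (by rw [Fintype.card_coe, hT])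
  have s1 : (fun t => (t, v)) ⁻¹' (φ ⁻¹' (closestSet d j T ∩ {z | numOnes z T = k / 2 + 1})) =
      {t | (∀ l, (t l).1 ∈ B) ∧
        (Finset.univ.filter fun l => (t l).2 = true).card = k / 2 + 1} := by
    ext t
    simp only [Set.mem_preimage, Set.mem_inter_iff, Set.mem_ofPred_eq, e1, e2]
  have s2 : (fun t => (t, v)) ⁻¹' (φ ⁻¹' closestSet d j T) = {t | ∀ l, (t l).1 ∈ B} := by
    ext t
    simp only [Set.mem_preimage, Set.mem_ofPred_eq, e1]
  rw [s1, s2]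
  convert key

lemma mem_closestSet_nearestNeighbors {z : Fin m → EuclideanSpace ℝ (Fin d) × Bool}
    (hz : NoTies fun i => (z i).1) (k : ℕ) (j : Fin m) :
    z ∈ closestSet d j (nearestNeighbors (fun i => (z i).1) (Finset.univ.erase j) k (z j).1) := by
  intro i hi l hl
  have hlj := (Finset.mem_erase.1 (Finset.mem_sdiff.1 hl).1).1
  have hij := (Finset.mem_erase.1 (nearestNeighbors_subset hi)).1
  have hil : i ≠ l := fun h => (Finset.mem_sdiff.1 hl).2 (h ▸ hi)
  exact (closer_of_nearestNeighbors_eq rfl hi hl).resolve_right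
    fun h => hz j i l hij hlj hil h.1

/-- The vote among the `k + 1` nearest neighbours of a sample point is unlikely to be tight. -/
lemma pi_numOnes_nearestNeighbors_le
    (hP : ∀ᵐ z ∂(Measure.pi fun _ : Fin m => P), NoTies fun i => (z i).1) {k : ℕ}
    (hk : k + 2 ≤ m) (j : Fin m) :
    Measure.pi (fun _ : Fin m => P) {z | numOnes z (nearestNeighbors (fun i => (z i).1)
        (Finset.univ.erase j) (k + 1) (z j).1) = k / 2 + 1} ≤
      ENNReal.ofReal (2 / √(k + 1)) := by
  set 𝒯 := (Finset.univ.erase j).powersetCard (k + 1)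
  have h𝒯 : ∀ T ∈ 𝒯, T ⊆ Finset.univ.erase j ∧ T.card = k + 1 := fun T hT =>
    Finset.mem_powersetCard.1 hT
  have hnn : ∀ T ∈ 𝒯, ∀ z ∈ closestSet d j T, nearestNeighbors (fun i => (z i).1)
      (Finset.univ.erase j) (k + 1) (z j).1 = T := fun T hT z hz =>
    nearestNeighbors_eq_of_dist_lt (h𝒯 T hT).1 (h𝒯 T hT).2 hz
  have hdet : ∀ z : Fin m → EuclideanSpace ℝ (Fin d) × Bool, (NoTies fun i => (z i).1) →
      numOnes z (nearestNeighbors (fun i => (z i).1) (Finset.univ.erase j) (k + 1) (z j).1) =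
        k / 2 + 1 → z ∈ ⋃ T ∈ 𝒯, (closestSet d j T ∩ {z | numOnes z T = k / 2 + 1}) := by
    intro z hz hzs
    have hcard := card_nearestNeighbors (x := fun i => (z i).1) (u := (z j).1)
      (e := Finset.univ.erase j) (k := k + 1) (by
        rw [Finset.card_erase_of_mem (Finset.mem_univ _), Finset.card_univ, Fintype.card_fin]
        omega)
    exact Set.mem_iUnion₂.2 ⟨_, Finset.mem_powersetCard.2 ⟨nearestNeighbors_subset, hcard⟩,
      mem_closestSet_nearestNeighbors hz _ _, hzs⟩
  have hsub : ∀ᵐ z ∂(Measure.pi fun _ : Fin m => P),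
      z ∈ {z | numOnes z (nearestNeighbors (fun i => (z i).1)
        (Finset.univ.erase j) (k + 1) (z j).1) = k / 2 + 1} →
      z ∈ ⋃ T ∈ 𝒯, (closestSet d j T ∩ {z | numOnes z T = k / 2 + 1}) :=
    hP.mono fun z hz hzs => hdet z hz hzs
  calc _ ≤ _ := measure_mono_ae hsub
    _ ≤ ∑ T ∈ 𝒯, Measure.pi (fun _ : Fin m => P)
        (closestSet d j T ∩ {z | numOnes z T = k / 2 + 1}) := measure_biUnion_finset_le _ _
    _ ≤ ∑ T ∈ 𝒯, ENNReal.ofReal (2 / √(k + 1)) *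
        Measure.pi (fun _ : Fin m => P) (closestSet d j T) := Finset.sum_le_sum fun T hT =>
          pi_closestSet_inter_le P j (fun h => by simpa using (h𝒯 T hT).1 h) (h𝒯 T hT).2
    _ = ENNReal.ofReal (2 / √(k + 1)) *
        Measure.pi (fun _ : Fin m => P) (⋃ T ∈ 𝒯, closestSet d j T) := by
          rw [← Finset.mul_sum, measure_biUnion_finset _ fun T _ => measurableSet_closestSet j T]
          -- A sample in `closestSet d j T` has `T` as its set of `k + 1` nearest neighbours of `j`,
          -- which determines `T`.
          intro T hT T' hT' hne
          exact Set.disjoint_left.2 fun z hz hz' => hne ((hnn T hT z hz).symm.trans (hnn T' hT' z hz'))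
    _ ≤ ENNReal.ofReal (2 / √(k + 1)) * 1 := by gcongr; exact prob_le_one
    _ = _ := mul_one _

end VoteMeasurability

/-! ### Stability of the leave-one-out estimator -/

section LeaveOneOut

variable {d m : ℕ}

/-- The loss of the `k`NN classifier at the point `i`, when it is built from the other points. -/
noncomputable def looLoss (k : ℕ) (i : Fin m) (z : Fin m → EuclideanSpace ℝ (Fin d) × Bool) : ℝ :=
  if knnClassifier k (Finset.univ.erase i) z (z i).1 ≠ (z i).2 then 1 else 0

lemma looLoss_nonneg (k : ℕ) (i : Fin m) (z : Fin m → EuclideanSpace ℝ (Fin d) × Bool) :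
    0 ≤ looLoss k i z := by unfold looLoss; split_ifs <;> norm_num

lemma looLoss_le_one (k : ℕ) (i : Fin m) (z : Fin m → EuclideanSpace ℝ (Fin d) × Bool) :
    looLoss k i z ≤ 1 := by unfold looLoss; split_ifs <;> norm_num

lemma knnLoo_eq (k : ℕ) (z : Fin m → EuclideanSpace ℝ (Fin d) × Bool) :
    knnLoo k z = (m : ℝ)⁻¹ * ∑ i, looLoss k i z := by
  -- For `m = 0` truncated subtraction makes the training size `0 - 1` equal to `0`, so the
  -- reindexing by omitted points fails; both sides are `0`.
  rcases Nat.eq_zero_or_pos m with rfl | hm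
  · simp [knnLoo, lpoEstimator]
  rw [knnLoo, lpoEstimator, Nat.choose_one_right]
  congr 1
  symm
  refine Finset.sum_nbij (fun i => Finset.univ.erase i) (fun i _ => ?_) (fun i _ j _ h => ?_)
    (fun e he => ?_) (fun i _ => ?_)
  · rw [Finset.mem_powersetCard]
    exact ⟨Finset.subset_univ _, by
      rw [Finset.card_erase_of_mem (Finset.mem_univ _), Finset.card_univ, Fintype.card_fin]⟩
  · exact (Finset.erase_inj _ (Finset.mem_univ i)).1 h
  · have hc := (Finset.mem_powersetCard.1 he).2
    have h1 : eᶜ.card = 1 := by rw [Finset.card_compl, hc, Fintype.card_fin]; omega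
    obtain ⟨i, hi⟩ := Finset.card_eq_one.1 h1
    refine ⟨i, Finset.mem_coe.2 (Finset.mem_univ _), ?_⟩
    simp only
    rw [← Finset.compl_singleton, ← hi, compl_compl]
  · have : (Finset.univ.erase i)ᶜ = {i} := by rw [← Finset.compl_singleton, compl_compl]
    rw [this, Finset.sum_singleton, looLoss]
    simp

/-- The point `i` is a neighbour of `j`, and the vote at `j` is tight. -/
def IsTight (k : ℕ) (i j : Fin m) (z : Fin m → EuclideanSpace ℝ (Fin d) × Bool) : Prop :=
  j ≠ i ∧ i ∈ nearestNeighbors (fun i => (z i).1) (Finset.univ.erase j) k (z j).1 ∧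
    numOnes z (nearestNeighbors (fun i => (z i).1) (Finset.univ.erase j) (k + 1) (z j).1) =
      k / 2 + 1

open Classical in
/-- The number of points at which the classifier may depend on the point `i`. -/
noncomputable def numTight (k : ℕ) (i : Fin m) (z : Fin m → EuclideanSpace ℝ (Fin d) × Bool) : ℝ :=
  ∑ j, if IsTight k i j z then 1 else 0

lemma BddMeas.ite_one {α : Type*} [MeasurableSpace α] {p : α → Prop} [DecidablePred p]
    (hp : MeasurableSet {z | p z}) : BddMeas fun z => if p z then (1 : ℝ) else 0 :=
  ⟨Measurable.ite hp measurable_const measurable_const, 1, fun z => by simp only; split_ifs <;> simp⟩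

lemma bddMeas_numTight (k : ℕ) (i : Fin m) :
    BddMeas (numTight k i : (Fin m → EuclideanSpace ℝ (Fin d) × Bool) → ℝ) := by
  classical
  refine BddMeas.sum _ fun j => BddMeas.ite_one ?_
  change MeasurableSet ({z : Fin m → EuclideanSpace ℝ (Fin d) × Bool | j ≠ i} ∩
    ({z | i ∈ nearestNeighbors (fun i => (z i).1) (Finset.univ.erase j) k (z j).1} ∩
      {z | numOnes z (nearestNeighbors (fun i => (z i).1) (Finset.univ.erase j) (k + 1) (z j).1) =
        k / 2 + 1}))
  exact (MeasurableSet.const _).inter ((measurableSet_mem_nearestNeighbors _ k i j).inter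
    (measurableSet_eq_fun (measurable_numOnes_nearestNeighbors _ (k + 1) j) measurable_const))

lemma bddMeas_knnLoo {k : ℕ} (hk : 1 ≤ k) :
    BddMeas (knnLoo k : (Fin m → EuclideanSpace ℝ (Fin d) × Bool) → ℝ) := by
  have : (knnLoo k : (Fin m → EuclideanSpace ℝ (Fin d) × Bool) → ℝ) =
      fun z => (m : ℝ)⁻¹ * ∑ i, looLoss k i z := funext fun z => knnLoo_eq k z
  rw [this]
  refine (BddMeas.const _).mul (BddMeas.sum _ fun i => ?_)
  exact BddMeas.ite_one (measurableSet_eq_fun (measurable_knnClassifier hk _ i)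
    (by fun_prop)).compl

lemma numTight_le {γ : ℝ} (hγ : IsStoneConstant d γ) (k : ℕ) (i : Fin m)
    {z : Fin m → EuclideanSpace ℝ (Fin d) × Bool} (hz : NoTies fun i => (z i).1) :
    numTight k i z ≤ k * γ := by
  classical
  refine le_trans ?_ (hγ.2 m _ hz k i)
  rw [numTight, Finset.sum_boole, Nat.cast_le]
  refine Finset.card_le_card fun j hj => ?_
  rw [Finset.mem_filter] at hj ⊢
  exact ⟨hj.1, hj.2.1, hj.2.2.1⟩

variable {z z' : Fin m → EuclideanSpace ℝ (Fin d) × Bool} {i : Fin m}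

-- Compare both classifiers at `j` with the one built without `i`, which is common to the two
-- samples: if they disagree, one of them differs from it, and its vote is tight.
open Classical in
lemma abs_looLoss_sub_le {k : ℕ} (hk : 1 ≤ k) (hm : k + 2 ≤ m) (h : ∀ l, l ≠ i → z l = z' l)
    {j : Fin m} (hj : j ≠ i) :
    |looLoss k j z - looLoss k j z'| ≤
      (if IsTight k i j z then 1 else 0) + (if IsTight k i j z' then 1 else 0) := by
  set e := Finset.univ.erase j with he
  have hi : i ∈ e := Finset.mem_erase.2 ⟨hj.symm, Finset.mem_univ _⟩
  have hec : k + 1 ≤ e.card := by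
    rw [he, Finset.card_erase_of_mem (Finset.mem_univ _), Finset.card_univ, Fintype.card_fin]
    omega
  have h1 : (0 : ℝ) ≤ if IsTight k i j z then 1 else 0 := by split_ifs <;> norm_num
  have h2 : (0 : ℝ) ≤ if IsTight k i j z' then 1 else 0 := by split_ifs <;> norm_num
  have hzj := h j hj
  by_cases heq : knnClassifier k e z (z j).1 = knnClassifier k e z' (z' j).1
  · have : looLoss k j z = looLoss k j z' := by rw [looLoss, looLoss, ← he, heq, hzj]
    rw [this, sub_self, abs_zero]
    exact add_nonneg h1 h2
  have hle : |looLoss k j z - looLoss k j z'| ≤ 1 := by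
    have h3 := looLoss_nonneg k j z
    have h4 := looLoss_nonneg k j z'
    have h5 := looLoss_le_one k j z
    have h6 := looLoss_le_one k j z'
    rw [abs_le]; constructor <;> linarith
  refine hle.trans ?_
  have hcongr : knnClassifier k (e.erase i) z (z j).1 = knnClassifier k (e.erase i) z' (z' j).1 := by
    rw [hzj]
    exact knnClassifier_congr fun l hl => h l (Finset.mem_erase.1 hl).1
  by_cases h3 : knnClassifier k e z (z j).1 = knnClassifier k (e.erase i) z (z j).1
  · have h4 : knnClassifier k e z' (z' j).1 ≠ knnClassifier k (e.erase i) z' (z' j).1 := fun h4 =>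
      heq (h3.trans (hcongr.trans h4.symm))
    have : IsTight k i j z' := ⟨hj, mem_and_numOnes_eq_of_knnClassifier_ne hk hi hec h4⟩
    rw [if_pos this]; linarith
  · have : IsTight k i j z := ⟨hj, mem_and_numOnes_eq_of_knnClassifier_ne hk hi hec h3⟩
    rw [if_pos this]; linarith

lemma abs_knnLoo_sub_le {k : ℕ} (hk : 1 ≤ k) (hm : k + 2 ≤ m) (h : ∀ l, l ≠ i → z l = z' l) :
    |knnLoo k z - knnLoo k z'| ≤ (m : ℝ)⁻¹ * (1 + numTight k i z + numTight k i z') := by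
  classical
  rw [knnLoo_eq, knnLoo_eq, ← mul_sub, abs_mul, abs_of_nonneg (by positivity : 0 ≤ (m : ℝ)⁻¹),
    ← Finset.sum_sub_distrib]
  gcongr
  -- The term 1 pays for the loss at `i` itself, where the point and its label change.
  have hone : (1 : ℝ) = ∑ j, if j = i then 1 else 0 := by simp
  rw [hone, numTight, numTight, ← Finset.sum_add_distrib, ← Finset.sum_add_distrib]
  refine (Finset.abs_sum_le_sum_abs _ _).trans (Finset.sum_le_sum fun j _ => ?_)
  by_cases hj : j = i
  · rw [if_pos hj]
    have h1 : (0 : ℝ) ≤ if IsTight k i j z then 1 else 0 := by split_ifs <;> norm_num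
    have h2 : (0 : ℝ) ≤ if IsTight k i j z' then 1 else 0 := by split_ifs <;> norm_num
    have h3 := looLoss_nonneg k j z
    have h4 := looLoss_nonneg k j z'
    have h5 := looLoss_le_one k j z
    have h6 := looLoss_le_one k j z'
    rw [abs_le]; constructor <;> linarith
  · rw [if_neg hj, zero_add]
    exact abs_looLoss_sub_le hk hm h hj

lemma knnLoo_nonneg (k : ℕ) (z : Fin m → EuclideanSpace ℝ (Fin d) × Bool) : 0 ≤ knnLoo k z := by
  rw [knnLoo_eq]
  exact mul_nonneg (by positivity) (Finset.sum_nonneg fun i _ => looLoss_nonneg k i z)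

lemma knnLoo_le_one (k : ℕ) (z : Fin m → EuclideanSpace ℝ (Fin d) × Bool) : knnLoo k z ≤ 1 := by
  rw [knnLoo_eq, inv_mul_eq_div]
  refine div_le_one_of_le₀ ?_ (by positivity)
  refine (Finset.sum_le_sum fun i _ => looLoss_le_one k i z).trans (by simp)

lemma abs_knnLoo_sub_le_of_noTies {γ : ℝ} (hγ : IsStoneConstant d γ) (hγ1 : 1 ≤ γ) {k : ℕ}
    (hk : 1 ≤ k) (hm : k + 1 ≤ m) (h : ∀ l, l ≠ i → z l = z' l)
    (hz : NoTies fun i => (z i).1) (hz' : NoTies fun i => (z' i).1) :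
    |knnLoo k z - knnLoo k z'| ≤ (m : ℝ)⁻¹ * (1 + 2 * (k * γ)) := by
  have hm0 : (0 : ℝ) < m := by exact_mod_cast (by omega : 0 < m)
  -- If `m = k + 1`, there is no `(k + 1)`-th neighbour and tightness is of no use; the bound is
  -- then at least 1, while the estimator lies in `[0, 1]`.
  rcases hm.eq_or_lt with rfl | hlt
  · have h3 := knnLoo_nonneg k z
    have h4 := knnLoo_nonneg k z'
    have h5 := knnLoo_le_one k z
    have h6 := knnLoo_le_one k z'
    have h7 : (1 : ℝ) ≤ ((k + 1 : ℕ) : ℝ)⁻¹ * (1 + 2 * (k * γ)) := by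
      rw [inv_mul_eq_div, le_div_iff₀ hm0]
      push_cast
      have : (k : ℝ) * 1 ≤ k * γ := by gcongr
      have : (0 : ℝ) ≤ k := by positivity
      linarith
    rw [abs_le]; constructor <;> linarith
  · refine (abs_knnLoo_sub_le hk hlt h).trans ?_
    have h1 := numTight_le hγ k i hz
    have h2 := numTight_le hγ k i hz'
    exact mul_le_mul_of_nonneg_left (by linarith) (by positivity)

-- Double counting: a point `j` with a tight vote is charged only to its at most `k` neighbours.
open Classical in
lemma sum_numTight_le (k : ℕ) (z : Fin m → EuclideanSpace ℝ (Fin d) × Bool) :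
    ∑ i, numTight k i z ≤ k * ∑ j, if numOnes z (nearestNeighbors (fun i => (z i).1)
      (Finset.univ.erase j) (k + 1) (z j).1) = k / 2 + 1 then (1 : ℝ) else 0 := by
  unfold numTight
  rw [Finset.sum_comm, Finset.mul_sum]
  refine Finset.sum_le_sum fun j _ => ?_
  by_cases hS : numOnes z (nearestNeighbors (fun i => (z i).1)
      (Finset.univ.erase j) (k + 1) (z j).1) = k / 2 + 1
  · rw [if_pos hS, mul_one, Finset.sum_boole]
    refine le_trans ?_ (Nat.cast_le.2 (card_nearestNeighbors_le (x := fun i => (z i).1)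
      (u := (z j).1) (e := Finset.univ.erase j) (k := k)))
    rw [Nat.cast_le]
    exact Finset.card_le_card fun i hi => (Finset.mem_filter.1 hi).2.2.1
  · rw [if_neg hS, mul_zero]
    exact (Finset.sum_eq_zero fun i _ => if_neg fun h => hS h.2.2).le

end LeaveOneOut

/-! ### Moment bounds under the product law -/

section Moments

variable {d m : ℕ} (P : Measure (EuclideanSpace ℝ (Fin d) × Bool)) [IsProbabilityMeasure P]

lemma ae_noTies_update (hP : ∀ᵐ z ∂(Measure.pi fun _ : Fin m => P), NoTies fun i => (z i).1)
    (i : Fin m) :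
    ∀ᵐ w ∂((Measure.pi fun _ : Fin m => P).prod (Measure.pi fun _ : Fin m => P)),
      (NoTies fun l => (w.1 l).1) ∧
        NoTies fun l => (Function.update w.1 i (w.2 i) l).1 := by
  have h1 : MeasurePreserving Prod.fst
      ((Measure.pi fun _ : Fin m => P).prod (Measure.pi fun _ : Fin m => P))
      (Measure.pi fun _ : Fin m => P) := measurePreserving_fst
  have h2 := h1.comp (measurePreserving_swapOn (fun _ : Fin m => P) {i})
  filter_upwards [h1.quasiMeasurePreserving.ae hP, h2.quasiMeasurePreserving.ae hP] with w hw hw'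
  refine ⟨hw, ?_⟩
  simpa only [Function.comp_apply, swapOn_singleton_fst] using hw'

lemma update_eq_of_ne {w : (Fin m → EuclideanSpace ℝ (Fin d) × Bool) ×
    (Fin m → EuclideanSpace ℝ (Fin d) × Bool)} {i : Fin m} (l : Fin m) (hl : l ≠ i) :
    w.1 l = Function.update w.1 i (w.2 i) l := (Function.update_of_ne hl _ _).symm

lemma ae_abs_coordDiff_knnLoo_le
    (hP : ∀ᵐ z ∂(Measure.pi fun _ : Fin m => P), NoTies fun i => (z i).1)
    {γ : ℝ} (hγ : IsStoneConstant d γ) (hγ1 : 1 ≤ γ) {k : ℕ} (hk : 1 ≤ k) (hm : k + 1 ≤ m)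
    (i : Fin m) :
    ∀ᵐ w ∂((Measure.pi fun _ : Fin m => P).prod (Measure.pi fun _ : Fin m => P)),
      |coordDiff (knnLoo k) i w| ≤ (m : ℝ)⁻¹ * (1 + 2 * (k * γ)) := by
  filter_upwards [ae_noTies_update P hP i] with w hw
  exact abs_knnLoo_sub_le_of_noTies hγ hγ1 hk hm (update_eq_of_ne (i := i)) hw.1 hw.2

/-- The average number of points at which the vote is tight. -/
lemma sum_integral_numTight_le
    (hP : ∀ᵐ z ∂(Measure.pi fun _ : Fin m => P), NoTies fun i => (z i).1) {k : ℕ}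
    (hm : k + 2 ≤ m) :
    ∑ i, ∫ z, numTight k i z ∂(Measure.pi fun _ : Fin m => P) ≤
      k * (m * (2 / √(k + 1))) := by
  classical
  have hb : ∀ j : Fin m, BddMeas fun z : Fin m → EuclideanSpace ℝ (Fin d) × Bool =>
      if numOnes z (nearestNeighbors (fun i => (z i).1)
        (Finset.univ.erase j) (k + 1) (z j).1) = k / 2 + 1 then (1 : ℝ) else 0 := fun j =>
    BddMeas.ite_one (measurableSet_eq_fun (measurable_numOnes_nearestNeighbors _ _ _)
      measurable_const)
  have hj : ∀ j : Fin m, ∫ z, (if numOnes z (nearestNeighbors (fun i => (z i).1)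
        (Finset.univ.erase j) (k + 1) (z j).1) = k / 2 + 1 then (1 : ℝ) else 0)
        ∂(Measure.pi fun _ : Fin m => P) ≤ 2 / √(k + 1) := fun j => by
    have hms : MeasurableSet {z : Fin m → EuclideanSpace ℝ (Fin d) × Bool |
        numOnes z (nearestNeighbors (fun i => (z i).1)
        (Finset.univ.erase j) (k + 1) (z j).1) = k / 2 + 1} :=
      measurableSet_eq_fun (measurable_numOnes_nearestNeighbors _ _ _) measurable_const
    have h1 := integral_indicator_one (μ := Measure.pi fun _ : Fin m => P) hms
    have h2 := pi_numOnes_nearestNeighbors_le P hP hm j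
    calc _ = (Measure.pi fun _ : Fin m => P).real {z | numOnes z (nearestNeighbors
          (fun i => (z i).1) (Finset.univ.erase j) (k + 1) (z j).1) = k / 2 + 1} := by
          rw [← h1]
          refine integral_congr_ae (Filter.Eventually.of_forall fun z => ?_)
          simp only [Set.indicator_apply, Set.mem_ofPred_eq, Pi.one_apply]
      _ ≤ _ := ENNReal.toReal_le_of_le_ofReal (by positivity) h2
  rw [← integral_finsetSum _ fun i _ => (bddMeas_numTight k i).integrable _]
  calc _ ≤ ∫ z, k * ∑ j, (if numOnes z (nearestNeighbors (fun i => (z i).1)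
        (Finset.univ.erase j) (k + 1) (z j).1) = k / 2 + 1 then (1 : ℝ) else 0)
        ∂(Measure.pi fun _ : Fin m => P) := by
        refine integral_mono ((BddMeas.sum _ fun i => bddMeas_numTight k i).integrable _)
          (((BddMeas.sum _ hb).integrable _).const_mul _) fun z => ?_
        exact sum_numTight_le k z
    _ = k * ∑ j : Fin m, ∫ z, (if numOnes z (nearestNeighbors (fun i => (z i).1)
        (Finset.univ.erase j) (k + 1) (z j).1) = k / 2 + 1 then (1 : ℝ) else 0)
        ∂(Measure.pi fun _ : Fin m => P) := by
        rw [integral_const_mul, integral_finsetSum _ fun j _ => (hb j).integrable _]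
    _ ≤ k * ∑ j : Fin m, 2 / √(k + 1) := by
        gcongr with j
        exact hj j
    _ = _ := by simp

lemma integral_sumSqDiff_knnLoo_le
    (hP : ∀ᵐ z ∂(Measure.pi fun _ : Fin m => P), NoTies fun i => (z i).1)
    {γ : ℝ} (hγ : IsStoneConstant d γ) (hγ1 : 1 ≤ γ) {k : ℕ} (hk : 1 ≤ k) (hm : k + 2 ≤ m) :
    ∫ w, sumSqDiff (knnLoo k) w
        ∂((Measure.pi fun _ : Fin m => P).prod (Measure.pi fun _ : Fin m => P)) ≤
      (1 + 2 * (k * γ)) * (1 + 4 * √k) / m := by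
  set ν := (Measure.pi fun _ : Fin m => P).prod (Measure.pi fun _ : Fin m => P) with hν
  have hm0 : (0 : ℝ) < m := by exact_mod_cast (by omega : 0 < m)
  have hk0 : (0 : ℝ) < k := by exact_mod_cast hk
  have hf := bddMeas_knnLoo (d := d) (m := m) hk
  have hT : ∀ i : Fin m, BddMeas (numTight k i : (Fin m → EuclideanSpace ℝ (Fin d) × Bool) → ℝ) :=
    bddMeas_numTight k
  have hT' := fun i : Fin m => (hT i).comp (measurable_update_pair i)
  have hsw : ∀ i : Fin m, ∫ w, numTight k i (Function.update w.1 i (w.2 i)) ∂ν =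
      ∫ z, numTight k i z ∂(Measure.pi fun _ : Fin m => P) := fun i => by
    rw [← integral_prod_fst (fun _ : Fin m => P) (numTight k i),
      ← (hT i).fst.integral_swapOn (fun _ : Fin m => P) {i}]
    simp only [swapOn_singleton_fst, hν]
  have hsq : ∀ i : Fin m, ∫ w, (coordDiff (knnLoo k) i w) ^ 2 ∂ν ≤
      (m : ℝ)⁻¹ ^ 2 * (1 + 2 * (k * γ)) *
        (1 + 2 * ∫ z, numTight k i z ∂(Measure.pi fun _ : Fin m => P)) := fun i => by
    have hB : BddMeas fun w : (Fin m → EuclideanSpace ℝ (Fin d) × Bool) ×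
        (Fin m → EuclideanSpace ℝ (Fin d) × Bool) =>
        1 + numTight k i w.1 + numTight k i (Function.update w.1 i (w.2 i)) :=
      ((BddMeas.const 1).add (hT i).fst).add (hT' i)
    calc _ ≤ ∫ w, (m : ℝ)⁻¹ ^ 2 * (1 + 2 * (k * γ)) *
          (1 + numTight k i w.1 + numTight k i (Function.update w.1 i (w.2 i))) ∂ν := by
          refine integral_mono_ae (((hf.coordDiff i).pow 2).integrable ν)
            ((hB.integrable ν).const_mul _) ?_
          filter_upwards [ae_abs_coordDiff_knnLoo_le P hP hγ hγ1 hk (by omega) i] with w hw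
          have h1 : |coordDiff (knnLoo k) i w| ≤ (m : ℝ)⁻¹ * (1 + numTight k i w.1 +
              numTight k i (Function.update w.1 i (w.2 i))) :=
            abs_knnLoo_sub_le hk hm (update_eq_of_ne (i := i))
          -- Only one factor of the square is bounded uniformly; the other keeps the tight counts,
          -- whose expectations are small after summation over `i`.
          rw [← sq_abs, sq]
          refine (mul_le_mul hw h1 (abs_nonneg _) ((abs_nonneg _).trans hw)).trans (le_of_eq ?_)
          ring
      _ = _ := by
          rw [integral_const_mul, integral_add (((BddMeas.const 1).add (hT i).fst).integrable ν)
            ((hT' i).integrable ν), integral_add (integrable_const _) ((hT i).fst.integrable ν),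
            hsw i, hν, integral_prod_fst, integral_const, probReal_univ, one_smul]
          ring
  have hsum := sum_integral_numTight_le P hP hm
  have hk1 : k * (m * (2 / √(k + 1))) ≤ m * (2 * √k) := by
    have h1 : (0 : ℝ) < √k := Real.sqrt_pos.2 hk0
    have h2 : √(k : ℝ) * √k = k := Real.mul_self_sqrt hk0.le
    calc k * (m * (2 / √(k + 1))) ≤ k * (m * (2 / √k)) := by
          gcongr
          linarith
      _ = m * (2 * √k) := by
          field_simp
          rw [sq, h2]
  calc _ = ∑ i, ∫ w, (coordDiff (knnLoo k) i w) ^ 2 ∂ν := by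
        unfold sumSqDiff
        exact integral_finsetSum _ fun i _ => ((hf.coordDiff i).pow 2).integrable ν
    _ ≤ ∑ i, (m : ℝ)⁻¹ ^ 2 * (1 + 2 * (k * γ)) *
        (1 + 2 * ∫ z, numTight k i z ∂(Measure.pi fun _ : Fin m => P)) :=
        Finset.sum_le_sum fun i _ => hsq i
    _ = (m : ℝ)⁻¹ ^ 2 * (1 + 2 * (k * γ)) *
        (m + 2 * ∑ i, ∫ z, numTight k i z ∂(Measure.pi fun _ : Fin m => P)) := by
        rw [← Finset.mul_sum, Finset.sum_add_distrib, ← Finset.mul_sum]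
        simp
    _ ≤ (m : ℝ)⁻¹ ^ 2 * (1 + 2 * (k * γ)) * (m + 2 * (m * (2 * √k))) := by
        have : 0 ≤ (m : ℝ)⁻¹ ^ 2 * (1 + 2 * (k * γ)) := by
          have := hγ.1; positivity
        gcongr
        exact hsum.trans hk1
    _ = _ := by field_simp; ring

lemma integral_sq_knnLoo_sub_le
    (hP : ∀ᵐ z ∂(Measure.pi fun _ : Fin m => P), NoTies fun i => (z i).1)
    {γ : ℝ} (hγ : IsStoneConstant d γ) (hγ1 : 1 ≤ γ) {k : ℕ} (hk : 1 ≤ k) (hm : k + 1 ≤ m) :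
    ∫ z, (knnLoo k z - ∫ z', knnLoo k z' ∂(Measure.pi fun _ : Fin m => P)) ^ 2
        ∂(Measure.pi fun _ : Fin m => P) ≤
      (2 + 16 * γ) * √k * (√k / √m) ^ 2 := by
  have hm0 : (0 : ℝ) < m := by exact_mod_cast (by omega : 0 < m)
  have hk1 : (1 : ℝ) ≤ k := by exact_mod_cast hk
  have hs : 1 ≤ √(k : ℝ) := Real.one_le_sqrt.2 hk1
  have hf := bddMeas_knnLoo (d := d) (m := m) hk
  set c := ∫ z', knnLoo k z' ∂(Measure.pi fun _ : Fin m => P) with hc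
  have hrhs : (2 + 16 * γ) * √k * (√k / √m) ^ 2 = (2 + 16 * γ) * √k * k / m := by
    rw [div_pow, Real.sq_sqrt (by positivity), Real.sq_sqrt hm0.le]; ring
  rw [hrhs]
  have hfc : BddMeas fun z : Fin m → EuclideanSpace ℝ (Fin d) × Bool => knnLoo k z - c :=
    hf.sub (BddMeas.const c)
  -- For `m = k + 1` the variance is at most 1, and the right-hand side is at least `2k / (k + 1) ≥
  -- 1`.
  rcases hm.eq_or_lt with rfl | hlt
  · have hc0 : 0 ≤ c := integral_nonneg fun z => knnLoo_nonneg k z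
    have hc1 : c ≤ 1 := by
      have := integral_mono (hf.integrable (Measure.pi fun _ => P)) (integrable_const (1 : ℝ))
        fun z => knnLoo_le_one k z
      simpa [hc] using this
    calc _ ≤ ∫ z, (1 : ℝ) ∂(Measure.pi fun _ : Fin (k + 1) => P) := by
          refine integral_mono ((hfc.pow 2).integrable _) (integrable_const _) fun z => ?_
          have h3 := knnLoo_nonneg k z
          have h4 := knnLoo_le_one k z
          simp only
          nlinarith
      _ = 1 := by simp
      _ ≤ _ := by
          rw [le_div_iff₀ hm0]
          push_cast
          have h1 : 2 ≤ (2 + 16 * γ) * √k := by nlinarith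
          nlinarith
  · have h0 : ∫ z, (knnLoo k z - c) ∂(Measure.pi fun _ : Fin m => P) = 0 := by
      rw [integral_sub (hf.integrable _) (integrable_const _)]; simp [hc]
    have hV : sumSqDiff (fun z : Fin m → EuclideanSpace ℝ (Fin d) × Bool => knnLoo k z - c) =
        sumSqDiff (knnLoo k) := by
      funext w; simp [sumSqDiff, coordDiff]
    have h1 := integral_sq_le_of_bddMeas (fun _ : Fin m => P) hfc h0
    rw [hV] at h1
    refine h1.trans ((integral_sumSqDiff_knnLoo_le P hP hγ hγ1 hk hlt).trans ?_)
    refine div_le_div_of_nonneg_right ?_ hm0.le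
    have hsk : √(k : ℝ) * √k = k := Real.mul_self_sqrt (by positivity)
    set s := √(k : ℝ)
    rw [← hsk] at hk1 ⊢
    -- With `s = √k ≥ 1` and `γ ≥ 1`, every term of `(1 + 2kγ)(1 + 4√k)` is bounded by a multiple of
    -- `s³ γ` or `s³`; the total fits under `2 s³ + 16 s³ γ`.
    have e1 : 1 ≤ s * (s * s) := by nlinarith
    have e2 : s ≤ s * (s * s) := by nlinarith
    have e3 : s * s * γ ≤ s * (s * s) * γ := by
      have : s * s ≤ s * (s * s) := by nlinarith
      gcongr
    have e4 : s * (s * s) ≤ s * (s * s) * γ := le_mul_of_one_le_right (by positivity) hγ1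
    nlinarith

lemma integral_abs_rpow_knnLoo_sub_le
    (hP : ∀ᵐ z ∂(Measure.pi fun _ : Fin m => P), NoTies fun i => (z i).1)
    {γ : ℝ} (hγ : IsStoneConstant d γ) (hγ1 : 1 ≤ γ) {κ : ℝ} (hκ : IsEfronSteinConstant κ)
    {k : ℕ} (hk : 1 ≤ k) (hm : k + 1 ≤ m) {q : ℝ} (hq : 2 ≤ q) :
    ∫ z, |knnLoo k z - ∫ z', knnLoo k z' ∂(Measure.pi fun _ : Fin m => P)| ^ q
        ∂(Measure.pi fun _ : Fin m => P) ≤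
      (4 * γ * √(2 * κ) * √q) ^ q * (k / √m) ^ q := by
  have hm0 : (0 : ℝ) < m := by exact_mod_cast (by omega : 0 < m)
  have hk1 : (1 : ℝ) ≤ k := by exact_mod_cast hk
  have hf := bddMeas_knnLoo (d := d) (m := m) hk
  have key := hκ.2 m _ (fun _ => P) (knnLoo k) hf.1 (hf.integrable _) q hq
  set c := ∫ z', knnLoo k z' ∂(Measure.pi fun _ : Fin m => P)
  set X := ∫ z, |knnLoo k z - c| ^ q ∂(Measure.pi fun _ : Fin m => P)
  have hX0 : 0 ≤ X := integral_nonneg fun z => by positivity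
  set b := 1 + 2 * (k * γ) with hb
  have hV : eLpNorm (sumSqDiff (knnLoo k)) (ENNReal.ofReal (q / 2))
      ((Measure.pi fun _ : Fin m => P).prod (Measure.pi fun _ : Fin m => P)) ≤
        ENNReal.ofReal (b ^ 2 / m) := by
    refine (eLpNorm_le_of_ae_bound (C := b ^ 2 / m) ?_).trans (by simp)
    filter_upwards [ae_all_iff.2 fun i : Fin m =>
      ae_abs_coordDiff_knnLoo_le P hP hγ hγ1 hk hm i] with w hw
    unfold sumSqDiff
    rw [Real.norm_of_nonneg (Finset.sum_nonneg fun _ _ => sq_nonneg _)]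
    calc _ ≤ ∑ i : Fin m, ((m : ℝ)⁻¹ * b) ^ 2 := Finset.sum_le_sum fun i _ => by
          rw [← sq_abs]
          exact pow_le_pow_left₀ (abs_nonneg _) (hw i) 2
      _ = _ := by simp; field_simp
  have key2 := key.trans (mul_le_mul_right (ENNReal.rpow_le_rpow hV (by norm_num)) _)
  rw [eLpNorm_ofReal_eq (hf.sub (BddMeas.const c)) (by linarith),
    ENNReal.ofReal_rpow_of_nonneg (by positivity) (by norm_num),
    ← ENNReal.ofReal_mul (by positivity), ENNReal.ofReal_le_ofReal_iff (by positivity),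
    ← Real.sqrt_eq_rpow] at key2
  have hb0 : 0 ≤ b := by have := hγ.1; positivity
  -- Here `1 ≤ 2kγ` is used, which explains the factor 4 in the constant.
  have hb4 : b ≤ 4 * γ * k := by nlinarith
  rw [Real.sqrt_div (by positivity), Real.sqrt_sq hb0, Real.sqrt_mul' _ (by linarith)] at key2
  have hγ0 := hγ.1
  rw [← Real.mul_rpow (by positivity) (by positivity)]
  calc X = (X ^ q⁻¹) ^ q := by rw [Real.rpow_inv_rpow hX0 (by linarith)]
    _ ≤ (√(2 * κ) * √q * (b / √m)) ^ q := by gcongr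
    _ ≤ (√(2 * κ) * √q * (4 * γ * k / √m)) ^ q := by gcongr
    _ = _ := by congr 1; ring

lemma measurableSet_noTies :
    MeasurableSet {z : Fin m → EuclideanSpace ℝ (Fin d) × Bool | NoTies fun i => (z i).1} := by
  simp only [NoTies, Set.ofPred_forall]
  refine MeasurableSet.iInter fun i => MeasurableSet.iInter fun j => MeasurableSet.iInter fun l =>
    MeasurableSet.iInter fun _ => MeasurableSet.iInter fun _ => MeasurableSet.iInter fun _ => ?_
  exact (measurableSet_eq_fun (by fun_prop) (by fun_prop)).compl

end Moments

/-! ### Transfer to an arbitrary probability space -/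

theorem mainTheorem5 :
    (IsEfronSteinConstant efronSteinConstant ∧ efronSteinConstant ≤ 1.271) ∧
    (∀ d : ℕ, IsStoneConstant d (stoneConstant d)) ∧
    ∀ (d m k : ℕ), 1 ≤ k → k + 1 ≤ m →
      ∀ {Ω : Type*} [MeasurableSpace Ω] (μ : Measure Ω) [IsProbabilityMeasure μ]
        (P : Measure (EuclideanSpace ℝ (Fin d) × Bool))
        (Z : Fin m → Ω → EuclideanSpace ℝ (Fin d) × Bool),
        (∀ i, Measurable (Z i)) → iIndepFun Z μ → (∀ i, Measure.map (Z i) μ = P) →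
        (∀ᵐ ω ∂μ, NoTies fun i => (Z i ω).1) →
        (∫ ω, (knnLoo k (fun i => Z i ω) - ∫ ω', knnLoo k (fun i => Z i ω') ∂μ) ^ 2 ∂μ ≤
            (2 + 16 * stoneConstant d) * √(k : ℝ) * (√(k : ℝ) / √(m : ℝ)) ^ 2) ∧
        ∀ q : ℝ, 2 < q →
          ∫ ω, |knnLoo k (fun i => Z i ω) - ∫ ω', knnLoo k (fun i => Z i ω') ∂μ| ^ q ∂μ ≤
            (4 * stoneConstant d * √(2 * efronSteinConstant) * √q) ^ q *
              ((k : ℝ) / √(m : ℝ)) ^ q := by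
  refine ⟨⟨isEfronSteinConstant_efronSteinConstant, efronSteinConstant_le_one.trans (by norm_num)⟩,
    isStoneConstant_stoneConstant, ?_⟩
  intro d m k hk hm Ω _ μ _ P Z hZ hind hlaw hties
  have hP : IsProbabilityMeasure P := by
    rw [← hlaw ⟨0, by omega⟩]
    exact Measure.isProbabilityMeasure_map (hZ _).aemeasurable
  have hZm : Measurable fun ω i => Z i ω := measurable_pi_lambda _ hZ
  have hmap : μ.map (fun ω i => Z i ω) = Measure.pi fun _ : Fin m => P := by
    rw [(iIndepFun_iff_map_fun_eq_pi_map fun i => (hZ i).aemeasurable).1 hind]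
    simp only [hlaw]
  have hPt : ∀ᵐ z ∂(Measure.pi fun _ : Fin m => P), NoTies fun i => (z i).1 := by
    rw [← hmap, ae_map_iff hZm.aemeasurable measurableSet_noTies]
    exact hties
  have htr : ∀ F : (Fin m → EuclideanSpace ℝ (Fin d) × Bool) → ℝ, Measurable F →
      ∫ ω, F (fun i => Z i ω) ∂μ = ∫ z, F z ∂(Measure.pi fun _ : Fin m => P) := fun F hF => by
    rw [← hmap, integral_map hZm.aemeasurable hF.aestronglyMeasurable]
  have hf : Measurable (knnLoo k : (Fin m → EuclideanSpace ℝ (Fin d) × Bool) → ℝ) :=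
    (bddMeas_knnLoo hk).1
  have hS := isStoneConstant_stoneConstant d
  have hS1 := one_le_stoneConstant d
  rw [htr _ hf]
  constructor
  · rw [htr (fun z => (knnLoo k z - _) ^ 2) ((hf.sub_const _).pow_const 2)]
    exact integral_sq_knnLoo_sub_le P hPt hS hS1 hk hm
  · intro q hq
    rw [htr (fun z => |knnLoo k z - _| ^ q) ((hf.sub_const _).abs.pow_const q)]
    exact integral_abs_rpow_knnLoo_sub_le P hPt hS hS1
      isEfronSteinConstant_efronSteinConstant hk hm hq.le
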